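/- For graphs $T,H$ let $\mathrm{ex}(n,T,H)$ denote the maximum number of (unlabelled, not necessarily induced) copies of $T$ in an $H$-free graph on $n$ vertices. (i) For all integers $s,t$ with $s\ge 2$ and $t\ge (s-1)!+1$ there are constants $c_1=c_1(s,t)>0$ and $c_2=c_2(s,t)>0$ such that for every integer $m\ge 2$ with $s\ge 2m-2$, $$c_1\, n^{m-\binom m2/s}\le \mathrm{ex}(n,K_m,K_{s,t})\quad\text{for all } n\ge m,\qquad \mathrm{ex}(n,K_m,K_{s,t})\le c_2\, n^{m-\binom m2/s}\quad\text{for all } n\ge 0.$$ In particular, for fixed $m\ge 2$, $s\ge 2m-2$ and $t\ge (s-1)!+1$ we have $\mathrm{ex}(n,K_m,K_{s,t})=\Theta\big(n^{m-\binom m2/s}\big)$. (ii) For all fixed integers $m\ge 2$ and $t\ge s\ge m-1$, as $n\to\infty$, $$\mathrm{ex}(n,K_m,K_{s,t})\le\Big(\frac1{m!}+o(1)\Big)(t-1)^{\frac{m(m-1)}{2s}}\,n^{m-\frac{m(m-1)}{2s}}.$$ (iii) For all fixed integers $m\ge 2$, $s\ge 2m-2$ and $t\ge (s-1)!+1$,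 as $n\to\infty$, $$\mathrm{ex}(n,K_m,K_{s,t})\ge\Big(\frac1{m!}+o(1)\Big)\,n^{m-\frac{m(m-1)}{2s}}.$$ The $o(1)$ terms are functions of $n$ that tend to $0$ as $n\to\infty$ and may depend on $m,s,t$. -/

import Mathlib

open Filter Topology
open scoped Nat

open scoped Classical in
/-- The generalized extremal number `ex(n, T, H)`: the maximum possible number of (unlabelled,
not necessarily induced) copies of `T` in an `H`-free simple graph on `n` vertices.
`SimpleGraph.copyCount G T` is the number of subgraphs of `G` isomorphic to `T`. -/
noncomputable def genExtremalNumber (n : ℕ) {V W : Type*} (T : SimpleGraph V)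
    (H : SimpleGraph W) : ℕ :=
  ({G : SimpleGraph (Fin n) | H.Free G} : Finset (SimpleGraph (Fin n))).sup
    (fun G => G.copyCount T)

/-- `ex(n, K_m, K_{s,t})`. -/
noncomputable def exCliqueBiclique (n m s t : ℕ) : ℕ :=
  genExtremalNumber n (SimpleGraph.completeGraph (Fin m))
    (completeBipartiteGraph (Fin s) (Fin t))

/-! ### Solutions of product systems, by commutative algebra -/

section ProductSystem

open MvPolynomial

/-! Upper bound. The neighbourhood of a vertex in a `K_{s,t}`-free graph is `K_{s-1,t}`-free, so
cliques can be counted by induction on their size: `(m+1) k_{m+1}` is the sum of `k_m` over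
neighbourhoods, the induction bounds each summand by a power of a degree, and the power mean
inequality reduces the sum to the count of stars `K_{1,s}`, which is at most `(t-1) * u.choose s` on
`u` vertices. This is `factorial_mul_cliqueCount_le`.

Lower bound. The projective norm graph lives on `K × Fˣ` with `|F| = q` and `[K : F] = s - 1`; `v`
and `w` are adjacent when `N(v.1 + w.1) = v.2 * w.2`. Two facts are needed.

It has no `K_{s,t}` for `t > (s-1)!`. The common neighbours of `s` vertices are solutions of a
square system `∏ i, (x i - a i j) = b j` in the Galois conjugates of one unknown
(`card_commonNeighbors_normAdj_le`). Such a system in `d` unknowns has at most `d!` values of each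
coordinate (`card_image_le_factorial_of_prod_sub_eq`): the polynomial ring is finite over the
algebra generated by the column products, the fibre over zero consists of the points given by
permutations, and Nakayama's lemma bounds the degree of each coordinate over that algebra by their
number.

It is pseudorandom. Codegrees are known exactly, so degrees into any vertex set have small variance
(`sum_sq_card_normAdj_sub_le`). Choosing clique vertices one at a time then gives almost the number
of cliques of a random graph of density `1 / q` (`le_factorial_mul_cliqueCount`), as long as `s ≥ 2m
- 2`.

For general `n`, a prime `q` slightly below `n ^ (1/s)` is used. The sharp constant needs primes in
`((1-ε)x, x]`, which a Wiener–Ikehara argument provides (`eventually_exists_prime_mem_Ioc`). -/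

theorem Valuation.le_one_of_prod_sub_le_one {ι L Γ : Type*} [Fintype ι] [Field L]
    [LinearOrderedCommGroupWithZero Γ] (v : Valuation L Γ) (x : ι → L) (c : ι → ι → L)
    (hc : ∀ i j, v (c i j) ≤ 1) (hcc : ∀ i j j', j ≠ j' → v (c i j - c i j') = 1)
    (hx : ∀ j, v (∏ i, (x i - c i j)) ≤ 1) (i : ι) : v (x i) ≤ 1 := by
  by_contra! hi
  -- A coordinate of value above `1` makes its factor exceed `1` in every column. As coordinate `i`
  -- does so, each column needs a factor below `1`, coming from a coordinate of value at most `1`.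
  have key : ∀ j, ∃ k, v (x k) ≤ 1 ∧ v (x k - c k j) < 1 := by
    intro j
    by_contra! h
    have hge : ∀ k, 1 ≤ v (x k - c k j) := by
      intro k
      by_cases hk : v (x k) ≤ 1
      · exact h k hk
      · push Not at hk
        rw [Valuation.map_sub_eq_of_lt_left _ ((hc k j).trans_lt hk)]
        exact hk.le
    have hlt : 1 < v (x i - c i j) := by
      rwa [Valuation.map_sub_eq_of_lt_left _ ((hc i j).trans_lt hi)]
    classical
    have : 1 < v (∏ k, (x k - c k j)) := by
      rw [map_prod, ← Finset.mul_prod_erase _ _ (Finset.mem_univ i)]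
      exact one_lt_mul_of_lt_of_le hlt
        (Finset.one_le_prod' fun k _ => hge k)
    exact absurd (hx j) this.not_ge
  choose τ hτ hτ' using key
  -- The entries of one row differ by units, so a coordinate is close to at most one of them. Hence
  -- `τ` is a permutation and hits `i` itself.
  have hinj : Function.Injective τ := by
    intro j j' hjj
    by_contra hne
    have h2 := hτ' j'
    rw [← hjj] at h2
    have h3 := hcc (τ j) j' j (Ne.symm hne)
    have h4 : v (c (τ j) j' - c (τ j) j) < 1 := by
      have : c (τ j) j' - c (τ j) j = (x (τ j) - c (τ j) j) - (x (τ j) - c (τ j) j') := by ring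
      rw [this]
      exact (v.map_sub _ _).trans_lt (max_lt (hτ' j) h2)
    exact h4.ne h3
  obtain ⟨j, rfl⟩ := (Finite.surjective_of_injective hinj) i
  exact absurd (hτ j) hi.not_ge

variable {ι K : Type*} [Fintype ι] [Field K]

/-- The polynomial `∏ i, (X i - a i j)`. -/
noncomputable def columnProd (a : ι → ι → K) (j : ι) : MvPolynomial ι K :=
  ∏ i, (X i - C (a i j))

/-- The subalgebra generated by the polynomials `columnProd a j`. -/
noncomputable abbrev columnAlg (a : ι → ι → K) : Subalgebra K (MvPolynomial ι K) :=
  Algebra.adjoin K (Set.range (columnProd a))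

theorem columnProd_mem (a : ι → ι → K) (j : ι) : columnProd a j ∈ columnAlg a :=
  Algebra.subset_adjoin ⟨j, rfl⟩

/-- The integral closure is the intersection of the valuation rings containing the base, so
`Valuation.le_one_of_prod_sub_le_one` decides integrality. Constants and their inverses lie in the
base, which makes the nonzero differences of the `a i j` units in each of these rings. -/
theorem isIntegral_X_columnAlg (a : ι → ι → K) (ha : ∀ i, Function.Injective (a i)) (i : ι) :
    IsIntegral (columnAlg a) (X i : MvPolynomial ι K) := by
  let L := FractionRing (MvPolynomial ι K)
  let g : columnAlg a →+* L :=
    (algebraMap (MvPolynomial ι K) L).comp (columnAlg a).val.toRingHom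
  have hg : Function.Injective g :=
    (IsFractionRing.injective (MvPolynomial ι K) L).comp Subtype.val_injective
  have hmem : algebraMap (MvPolynomial ι K) L (X i) ∈
      (integralClosure (Subring.closure (Set.range g)) L).toSubring := by
    rw [← iInf_valuationSubring_superset]
    simp only [Subring.mem_iInf]
    rintro ⟨V, hV⟩
    change _ ∈ V
    have hVg : ∀ y, V.valuation (g y) ≤ 1 := fun y =>
      (V.valuation_le_one_iff _).2 (hV ⟨y, rfl⟩)
    have hconst : ∀ k : K, V.valuation (algebraMap _ L (C k : MvPolynomial ι K)) ≤ 1 := fun k =>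
      hVg (algebraMap K (columnAlg a) k)
    rw [← V.valuation_le_one_iff]
    refine Valuation.le_one_of_prod_sub_le_one V.valuation
      (fun i => algebraMap (MvPolynomial ι K) L (X i))
      (fun i j => algebraMap (MvPolynomial ι K) L (C (a i j))) (fun i j => hconst _) ?_ ?_ i
    · intro i j j' hj
      have hne : a i j - a i j' ≠ 0 := sub_ne_zero.2 fun h => hj (ha i h)
      rw [← map_sub, ← map_sub]
      refine le_antisymm (hconst _) ?_
      have h1 : V.valuation (algebraMap _ L (C (a i j - a i j') : MvPolynomial ι K)) *
          V.valuation (algebraMap _ L (C (a i j - a i j')⁻¹ : MvPolynomial ι K)) = 1 := by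
        rw [← map_mul, ← map_mul, ← map_mul, mul_inv_cancel₀ hne]
        simp
      by_contra! hlt
      have := mul_lt_of_lt_of_le_one hlt (hconst (a i j - a i j')⁻¹)
      exact this.ne h1
    · intro j
      have := hVg ⟨columnProd a j, columnProd_mem a j⟩
      simpa [g, columnProd, map_prod] using this
  have hint : IsIntegral (Subring.closure (Set.range g)) (algebraMap (MvPolynomial ι K) L (X i)) :=
    hmem
  have hcl : ∀ y ∈ Subring.closure (Set.range g), y ∈ g.range := by
    intro y hy
    exact (Subring.closure_le.2 (by rintro _ ⟨z, rfl⟩; exact ⟨z, rfl⟩) : _ ≤ g.range) hy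
  let e : columnAlg a ≃+* g.range := RingEquiv.ofBijective g.rangeRestrict
    ⟨fun x y h => hg (congrArg Subtype.val h), g.rangeRestrict_surjective⟩
  let ψ : Subring.closure (Set.range g) →+* columnAlg a :=
    (e.symm : g.range →+* columnAlg a).comp (Subring.inclusion hcl)
  have h2 : IsIntegral (columnAlg a) (algebraMap (MvPolynomial ι K) L (X i)) := by
    refine hint.map_of_comp_eq ψ (RingHom.id L) ?_
    ext y
    have : e (ψ y) = Subring.inclusion hcl y := by simp [ψ]
    have h3 := congrArg Subtype.val this
    exact h3
  exact (isIntegral_algebraMap_iff (IsFractionRing.injective (MvPolynomial ι K) L)).1 h2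

theorem isIntegral_columnAlg (a : ι → ι → K) (ha : ∀ i, Function.Injective (a i)) :
    Algebra.IsIntegral (columnAlg a) (MvPolynomial ι K) := by
  constructor
  intro p
  induction p using MvPolynomial.induction_on with
  | C k => exact isIntegral_algebraMap (R := columnAlg a) (x := algebraMap K (columnAlg a) k)
  | add p q hp hq => exact hp.add hq
  | mul_X p i hp => exact hp.mul (isIntegral_X_columnAlg a ha i)

theorem finite_columnAlg (a : ι → ι → K) (ha : ∀ i, Function.Injective (a i)) :
    Module.Finite (columnAlg a) (MvPolynomial ι K) := by
  have := isIntegral_columnAlg a ha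
  have : Algebra.FiniteType (columnAlg a) (MvPolynomial ι K) :=
    Algebra.FiniteType.of_restrictScalars_finiteType K _ _
  exact Algebra.IsIntegral.finite

/-- The polynomial ring is algebraic over the generated algebra and has transcendence degree `card
ι`, which is also the number of generators. So the algebra is itself a polynomial ring, hence
integrally closed. -/
theorem algebraicIndependent_columnProd (a : ι → ι → K) (ha : ∀ i, Function.Injective (a i)) :
    AlgebraicIndependent K (columnProd a) := by
  have := isIntegral_columnAlg a ha
  have : Algebra.IsAlgebraic (Algebra.adjoin K (Set.range (columnProd a))) (MvPolynomial ι K) :=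
    inferInstance
  refine (Algebra.IsAlgebraic.isTranscendenceBasis_of_lift_le_trdeg_of_finite K
    (columnProd a) ?_).1
  rw [MvPolynomial.trdeg_of_isDomain]
  simp

theorem isIntegrallyClosed_columnAlg (a : ι → ι → K) (ha : ∀ i, Function.Injective (a i)) :
    IsIntegrallyClosed (columnAlg a) :=
  IsIntegrallyClosed.of_equiv (algebraicIndependent_columnProd a ha).aevalEquiv.toRingEquiv

/-- A polynomial vanishing at all points `i ↦ a i (σ i)`, for permutations `σ`, lies in the ideal
generated by the column products. -/
theorem mem_span_columnProd (a : ι → ι → K) (ha : ∀ i, Function.Injective (a i))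
    (p : MvPolynomial ι K) (hp : ∀ σ : Equiv.Perm ι, eval (fun i => a i (σ i)) p = 0) :
    p ∈ Ideal.span (Set.range (columnProd a)) := by
  classical
  set J := Ideal.span (Set.range (columnProd a)) with hJ
  by_contra hpJ
  have hQ : Submodule.colon J {p} ≠ ⊤ := by
    intro h
    apply hpJ
    have : (1 : MvPolynomial ι K) ∈ Submodule.colon J {p} := by rw [h]; trivial
    simpa using Submodule.mem_colon_singleton.1 this
  obtain ⟨M, hM, hQM⟩ := Ideal.exists_le_maximal _ hQ
  have hMp : M.IsPrime := hM.isPrime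
  have hJM : ∀ q ∈ J, q ∈ M := fun q hq =>
    hQM (Submodule.mem_colon_singleton.2 (by simpa using J.mul_mem_right p hq))
  have hex : ∀ j, ∃ i, X i - C (a i j) ∈ M := by
    intro j
    have h1 : columnProd a j ∈ M := hJM _ (Ideal.subset_span ⟨j, rfl⟩)
    obtain ⟨i, -, hi⟩ := Ideal.IsPrime.prod_mem_iff.1 h1
    exact ⟨i, hi⟩
  have huniq : ∀ i j j', X i - C (a i j) ∈ M → X i - C (a i j') ∈ M → j = j' := by
    intro i j j' h h'
    by_contra hne
    have h1 : (C (a i j' - a i j) : MvPolynomial ι K) ∈ M := by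
      have := M.sub_mem h h'
      simpa using this
    have hne' : a i j' - a i j ≠ 0 := sub_ne_zero.2 fun h => hne (ha i h).symm
    exact hMp.ne_top (Ideal.eq_top_of_isUnit_mem _ h1 ((isUnit_iff_ne_zero.2 hne').map C))
  choose τ hτ using hex
  have hinj : Function.Injective τ := fun j j' h => huniq (τ j) j j' (hτ j) (h ▸ hτ j')
  let e : ι ≃ ι := Equiv.ofBijective τ (Finite.injective_iff_bijective.1 hinj)
  have he : ∀ i, X i - C (a i (e.symm i)) ∈ M := fun i => by
    have := hτ (e.symm i)
    have h2 : τ (e.symm i) = i := e.apply_symm_apply i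
    rwa [h2] at this
  let z : ι → K := fun i => a i (e.symm i)
  -- `M` is the ideal of the permutation point `z`. The multiplier `u` is nonzero at `z`, and `u *
  -- (X i - C (z i))` is a multiple of a column product; locally at `z` the column products
  -- therefore generate the whole maximal ideal.
  let u : MvPolynomial ι K := ∏ i, ∏ k ∈ Finset.univ.erase i, (X k - C (a k (e.symm i)))
  have hu : u ∉ M := by
    intro hu
    obtain ⟨i, -, hi⟩ := Ideal.IsPrime.prod_mem_iff.1 hu
    obtain ⟨k, hk, hk'⟩ := Ideal.IsPrime.prod_mem_iff.1 hi
    have := huniq k _ _ hk' (he k)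
    exact (Finset.ne_of_mem_erase hk) (e.symm.injective this).symm
  have huX : ∀ i, u * (X i - C (z i)) ∈ J := by
    intro i
    have hd : columnProd a (e.symm i) ∣ u * (X i - C (z i)) := by
      rw [columnProd, ← Finset.prod_erase_mul _ _ (Finset.mem_univ i)]
      exact mul_dvd_mul_right (Finset.dvd_prod_of_mem
        (fun i => ∏ k ∈ Finset.univ.erase i, (X k - C (a k (e.symm i)))) (Finset.mem_univ i)) _
    obtain ⟨w, hw⟩ := hd
    rw [hw]
    exact J.mul_mem_right _ (Ideal.subset_span ⟨_, rfl⟩)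
  have hall : ∀ q : MvPolynomial ι K, u * (q - C (eval z q)) ∈ J := by
    intro q
    induction q using MvPolynomial.induction_on with
    | C k => simp
    | add p q hp hq =>
      have := J.add_mem hp hq
      simp only [map_add]
      convert this using 1
      ring
    | mul_X p i hp =>
      have := J.add_mem (J.mul_mem_right (X i) hp) (J.mul_mem_left (C (eval z p)) (huX i))
      simp only [map_mul, eval_X]
      convert this using 1
      ring
  have h0 := hall p
  rw [hp e.symm, map_zero, sub_zero] at h0
  exact hu (hQM (Submodule.mem_colon_singleton.2 h0))

/-- Every coordinate of a solution satisfies, over the algebra of column products, a monic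
polynomial of degree at most `(card ι)!`. -/
theorem natDegree_minpoly_X_le (a : ι → ι → K) (ha : ∀ i, Function.Injective (a i)) (i : ι) :
    (minpoly (columnAlg a) (X i : MvPolynomial ι K)).natDegree ≤ (Fintype.card ι)! := by
  classical
  have := finite_columnAlg a ha
  have := isIntegrallyClosed_columnAlg a ha
  let E : MvPolynomial ι K →ₗ[K] (Equiv.Perm ι → K) :=
    LinearMap.pi fun σ => (aeval (fun i => a i (σ i)) : MvPolynomial ι K →ₐ[K] K).toLinearMap
  have hE : ∀ p σ, E p σ = eval (fun i => a i (σ i)) p := fun p σ => by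
    simp [E]
  let n := Module.finrank K (LinearMap.range E)
  have hn : n ≤ (Fintype.card ι)! := by
    rw [← Fintype.card_perm, ← Module.finrank_fintype_fun_eq_card K]
    exact Submodule.finrank_le _
  let bs := Module.finBasis K (LinearMap.range E)
  choose e he using fun k => (bs k).2
  let I : Ideal (columnAlg a) :=
    Ideal.span (Set.range fun j => (⟨columnProd a j, columnProd_mem a j⟩ : columnAlg a))
  let N : Submodule (columnAlg a) (MvPolynomial ι K) := Submodule.span _ (Set.range e)
  have hIJ : (I • ⊤ : Submodule (columnAlg a) (MvPolynomial ι K)) =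
      (Ideal.span (Set.range (columnProd a))).restrictScalars (columnAlg a) := by
    rw [Ideal.smul_top_eq_map, Ideal.map_span, ← Set.range_comp]
    rfl
  -- By `mem_span_columnProd`, a polynomial is determined modulo the column products by its values
  -- at the permutation points, so lifts of a basis of the value space generate modulo `I`.
  have hsup : (⊤ : Submodule (columnAlg a) (MvPolynomial ι K)) ≤ N ⊔ I • ⊤ := by
    intro p _
    let c := bs.repr ⟨E p, ⟨p, rfl⟩⟩
    have hc : E p = ∑ k, c k • E (e k) := by
      have := congrArg Subtype.val (bs.sum_repr ⟨E p, ⟨p, rfl⟩⟩)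
      simp only [Submodule.coe_sum, Submodule.coe_smul] at this
      rw [← this]
      exact Finset.sum_congr rfl fun k _ => by rw [he]
    have hker : E (p - ∑ k, c k • e k) = 0 := by
      rw [map_sub, map_sum, hc]
      simp
    rw [← add_sub_cancel (∑ k, c k • e k) p]
    refine Submodule.add_mem_sup (Submodule.sum_mem _ fun k _ => ?_) ?_
    · have : c k • e k = algebraMap K (columnAlg a) (c k) • e k := by
        rw [algebraMap_smul]
      rw [this]
      exact N.smul_mem _ (Submodule.subset_span ⟨k, rfl⟩)
    · rw [hIJ]
      refine mem_span_columnProd a ha _ fun σ => ?_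
      rw [← hE, hker]
      rfl
  -- Nakayama: some `r` congruent to `1` modulo `I` multiplies the whole ring into the span of `n`
  -- elements. Then `r * X i ^ k` for `k = 0, …, n` are dependent.
  obtain ⟨r, hr, hrN⟩ := Submodule.exists_sub_one_mem_and_smul_le_of_fg_of_le_sup
    (Module.Finite.fg_top) le_rfl hsup
  have hr0 : r ≠ 0 := by
    rintro rfl
    let ev : columnAlg a →ₐ[K] K := (aeval fun i => a i i).comp (columnAlg a).val
    have hI : I ≤ RingHom.ker ev := by
      rw [Ideal.span_le]
      rintro _ ⟨j, rfl⟩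
      simp only [SetLike.mem_coe, RingHom.mem_ker]
      change aeval (fun i => a i i) (columnProd a j) = 0
      rw [columnProd, map_prod]
      exact Finset.prod_eq_zero (Finset.mem_univ j) (by simp)
    have := hI hr
    simp [RingHom.mem_ker] at this
  let v : Fin (n + 1) → MvPolynomial ι K := fun k => r • X i ^ (k : ℕ)
  have hv : ¬ LinearIndependent (columnAlg a) v := by
    intro hli
    have h1 := linearIndependent_le_span' v hli (Set.range e) (by
      rintro _ ⟨k, rfl⟩
      exact hrN (Submodule.smul_mem_pointwise_smul _ _ _ trivial))
    have h2 : Fintype.card (Set.range e) ≤ n := by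
      simpa using Fintype.card_range_le e
    rw [Cardinal.mk_fin, Nat.cast_le] at h1
    omega
  rw [Fintype.not_linearIndependent_iff] at hv
  obtain ⟨g, hg, k₀, hk₀⟩ := hv
  let P : Polynomial (columnAlg a) := ∑ k : Fin (n + 1), Polynomial.monomial (k : ℕ) (g k)
  have hcoeff : ∀ k : Fin (n + 1), P.coeff k = g k := by
    intro k
    simp only [P, Polynomial.finsetSum_coeff, Polynomial.coeff_monomial]
    simp [Fin.val_inj]
  have hP0 : P ≠ 0 := by
    intro h
    apply hk₀
    rw [← hcoeff, h, Polynomial.coeff_zero]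
  have hPdeg : P.natDegree ≤ n := by
    refine Polynomial.natDegree_sum_le_of_forall_le _ _ fun k _ => ?_
    exact (Polynomial.natDegree_monomial_le _).trans (Nat.lt_succ_iff.1 k.2)
  have hPX : Polynomial.aeval (X i : MvPolynomial ι K) P = 0 := by
    have h1 : r • Polynomial.aeval (X i : MvPolynomial ι K) P = 0 := by
      rw [← hg]
      simp only [P, map_sum, Polynomial.aeval_monomial, Finset.smul_sum, v]
      refine Finset.sum_congr rfl fun k _ => ?_
      rw [Algebra.smul_def, Algebra.smul_def, Algebra.smul_def]
      ring
    exact (smul_eq_zero.1 h1).resolve_left hr0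
  -- `P` need not be monic; since the base is integrally closed, the minimal polynomial still has
  -- least degree among all nonzero annihilators.
  have := minpoly.IsIntegrallyClosed.degree_le_of_ne_zero hP0 hPX
  exact (Polynomial.natDegree_le_natDegree this).trans (hPdeg.trans hn)

/-- The system `∏ i, (x i - a i j) = b j`, with the `a i j` pairwise distinct for each `i`, has at
most `(card ι)!` solutions up to equality of a fixed coordinate. -/
theorem card_image_le_factorial_of_prod_sub_eq [DecidableEq K] (a : ι → ι → K)
    (ha : ∀ i, Function.Injective (a i)) (b : ι → K) (S : Finset (ι → K))
    (hS : ∀ x ∈ S, ∀ j, ∏ i, (x i - a i j) = b j) (i : ι) :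
    (S.image fun x => x i).card ≤ (Fintype.card ι)! := by
  classical
  rcases S.eq_empty_or_nonempty with rfl | ⟨x₀, hx₀⟩
  · simp
  let ev : (ι → K) → (columnAlg a →ₐ[K] K) := fun x => (aeval x).comp (columnAlg a).val
  -- All solutions induce the same specialisation of the algebra, so their `i`-th coordinates are
  -- roots of one specialised minimal polynomial, nonzero because it is monic.
  have hev : ∀ x ∈ S, ev x = ev x₀ := by
    intro x hx
    refine AlgHom.adjoin_ext ?_
    rintro _ ⟨j, rfl⟩
    have h1 : ∀ y ∈ S, aeval y (columnProd a j) = b j := fun y hy => by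
      rw [columnProd, map_prod, ← hS y hy j]
      simp
    exact (h1 x hx).trans (h1 x₀ hx₀).symm
  have hint : IsIntegral (columnAlg a) (X i : MvPolynomial ι K) := isIntegral_X_columnAlg a ha i
  let μ := minpoly (columnAlg a) (X i : MvPolynomial ι K)
  have hμ : μ.Monic := minpoly.monic hint
  let Q : Polynomial K := μ.map (ev x₀ : columnAlg a →+* K)
  have hQ : Q ≠ 0 := (hμ.map _).ne_zero
  have hsub : (S.image fun x => x i) ⊆ Q.roots.toFinset := by
    intro y hy
    obtain ⟨x, hx, rfl⟩ := Finset.mem_image.1 hy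
    rw [Multiset.mem_toFinset, Polynomial.mem_roots hQ, Polynomial.IsRoot, Polynomial.eval_map,
      ← hev x hx]
    have h1 := congrArg (aeval x : MvPolynomial ι K →ₐ[K] K)
      (minpoly.aeval (columnAlg a) (X i : MvPolynomial ι K))
    rw [map_zero, Polynomial.aeval_def, ← AlgHom.coe_toRingHom, Polynomial.hom_eval₂] at h1
    have h2 : (aeval x : MvPolynomial ι K →ₐ[K] K) (X i) = x i := aeval_X _ _
    exact (congrArg (fun c => Polynomial.eval₂ _ c μ) h2).symm.trans h1
  calc (S.image fun x => x i).card ≤ Q.roots.toFinset.card := Finset.card_le_card hsub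
    _ ≤ Multiset.card Q.roots := Multiset.toFinset_card_le _
    _ ≤ Q.natDegree := Polynomial.card_roots' _
    _ ≤ μ.natDegree := Polynomial.natDegree_map_le
    _ ≤ _ := natDegree_minpoly_X_le a ha i

end ProductSystem

/-! ### The projective norm graph: common neighbours and degree variance -/

section ProjectiveNormGraph

variable {F K : Type*} [Field F] [Field K] [Algebra F K]

theorem Algebra.norm_inv_field [FiniteDimensional F K] (x : K) :
    Algebra.norm F x⁻¹ = (Algebra.norm F x)⁻¹ := by
  rcases eq_or_ne x 0 with rfl | hx
  · simp
  · refine eq_inv_of_mul_eq_one_left ?_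
    rw [← map_mul, inv_mul_cancel₀ hx, map_one]

/-- The adjacency relation of the projective norm graph, loops included. -/
def normAdj (v w : K × Fˣ) : Prop := Algebra.norm F (v.1 + w.1) = (v.2 : F) * w.2

theorem normAdj_comm {v w : K × Fˣ} : normAdj v w ↔ normAdj w v := by
  rw [normAdj, normAdj, add_comm, mul_comm]

theorem normAdj.add_ne_zero [FiniteDimensional F K] {v w : K × Fˣ} (h : normAdj v w) :
    v.1 + w.1 ≠ 0 := by
  intro h0
  rw [normAdj, h0, Algebra.norm_zero] at h
  exact (mul_ne_zero v.2.ne_zero w.2.ne_zero) h.symm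

theorem normAdj.snd_eq {v w w' : K × Fˣ} (h : normAdj v w) (h' : normAdj v w')
    (hw : w.1 = w'.1) : w = w' := by
  refine Prod.ext hw (Units.ext ?_)
  rw [normAdj] at h h'
  rw [hw, h'] at h
  exact (mul_left_cancel₀ v.2.ne_zero h).symm

variable [Fintype K]

open Classical in
theorem card_norm_eq (c : Fˣ) :
    (Finset.univ.filter fun z : K => Algebra.norm F z = c).card =
      (Finset.univ.filter fun z : K => Algebra.norm F z = 1).card := by
  obtain ⟨y, hy⟩ := FiniteField.unitsMap_norm_surjective F K c
  have hy' : Algebra.norm F (y : K) = c := congrArg Units.val hy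
  symm
  refine Finset.card_nbij' (fun z => z * y) (fun z => z * (y : K)⁻¹) ?_ ?_ ?_ ?_
  · intro z hz
    simp only [Finset.coe_filter, Finset.mem_univ, true_and, Set.mem_ofPred_eq] at hz ⊢
    rw [map_mul, hz, hy', one_mul]
  · intro z hz
    simp only [Finset.coe_filter, Finset.mem_univ, true_and, Set.mem_ofPred_eq] at hz ⊢
    rw [map_mul, hz, Algebra.norm_inv_field, hy', mul_inv_cancel₀ c.ne_zero]
  · intro z _
    simp
  · intro z _
    simp

variable [Fintype F]

open Classical in
/-- In the projective norm graph, `[K : F] + 1` vertices have at most `[K : F]!` common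
neighbours. -/
theorem card_commonNeighbors_normAdj_le (S : Finset (K × Fˣ))
    (hS : S.card = Module.finrank F K + 1) :
    (Finset.univ.filter fun w => ∀ v ∈ S, normAdj v w).card ≤ (Module.finrank F K)! := by
  set W := Finset.univ.filter fun w : K × Fˣ => ∀ v ∈ S, normAdj v w with hW
  rcases W.eq_empty_or_nonempty with h0 | ⟨w₀, hw₀⟩
  · rw [h0]; simp
  have hfst : ∀ v ∈ S, ∀ v' ∈ S, v.1 = v'.1 → v = v' := by
    intro v hv v' hv' h
    have h1 := (Finset.mem_filter.1 hw₀).2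
    exact (normAdj_comm.1 (h1 v hv)).snd_eq (normAdj_comm.1 (h1 v' hv')) h
  obtain ⟨u, hu⟩ : S.Nonempty := Finset.card_pos.1 (by omega)
  have hcard : Fintype.card (K ≃ₐ[F] K) = Module.finrank F K := by
    rw [← Nat.card_eq_fintype_card, IsGalois.card_aut_eq_finrank]
  -- The vertices of `S` other than `u` are as many as the automorphisms, so the Galois group can
  -- index both unknowns and equations.
  have e : (K ≃ₐ[F] K) ≃ (S.erase u : Finset (K × Fˣ)) := by
    refine Fintype.equivOfCardEq ?_
    rw [hcard, Fintype.card_coe, Finset.card_erase_of_mem hu, hS, Nat.add_sub_cancel]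
  have heS : ∀ τ, (e τ).1 ∈ S := fun τ => Finset.mem_of_mem_erase (e τ).2
  have hne : ∀ τ, (e τ).1.1 - u.1 ≠ 0 := fun τ h =>
    (Finset.ne_of_mem_erase (e τ).2) (hfst _ (heS τ) _ hu (sub_eq_zero.1 h))
  -- Dividing the equation at `v` by the one at `u` eliminates `w.2`. With `Y = 1 / (w.1 + u.1)` it
  -- becomes `N(Y + 1 / (v.1 - u.1)) = v.2 / (u.2 * N(v.1 - u.1))`, and the norm is the product of
  -- the conjugates.
  let a : (K ≃ₐ[F] K) → (K ≃ₐ[F] K) → K := fun σ τ => -σ ((e τ).1.1 - u.1)⁻¹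
  let b : (K ≃ₐ[F] K) → K := fun τ => algebraMap F K
    ((e τ).1.2 / (u.2 * Algebra.norm F ((e τ).1.1 - u.1)))
  have ha : ∀ σ, Function.Injective (a σ) := by
    intro σ τ τ' h
    have h1 := inv_injective (σ.injective (neg_injective h))
    exact e.injective (Subtype.ext (hfst _ (heS τ) _ (heS τ') (sub_left_injective h1)))
  let Y : K × Fˣ → K := fun w => (w.1 + u.1)⁻¹
  let x : K × Fˣ → (K ≃ₐ[F] K) → K := fun w σ => σ (Y w)
  have hx : ∀ z ∈ W.image x, ∀ τ, ∏ σ, (z σ - a σ τ) = b τ := by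
    intro z hz τ
    obtain ⟨w, hw, rfl⟩ := Finset.mem_image.1 hz
    have hadj := (Finset.mem_filter.1 hw).2
    have hwu : w.1 + u.1 ≠ 0 := (normAdj_comm.1 (hadj u hu)).add_ne_zero
    have h1 : ∀ σ, x w σ - a σ τ = σ (Y w + ((e τ).1.1 - u.1)⁻¹) := fun σ => by
      simp [x, a]
    simp only [h1]
    rw [← Algebra.norm_eq_prod_automorphisms]
    have h2 : Y w + ((e τ).1.1 - u.1)⁻¹ =
        ((e τ).1.1 + w.1) * ((u.1 + w.1) * ((e τ).1.1 - u.1))⁻¹ := by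
      have := hne τ
      have h3 : u.1 + w.1 ≠ 0 := by rwa [add_comm]
      simp only [Y]
      rw [add_comm w.1]
      field_simp
      ring
    have h4 := hadj _ (heS τ)
    have h5 := hadj u hu
    rw [normAdj] at h4 h5
    rw [h2, map_mul (Algebra.norm F), h4, Algebra.norm_inv_field, map_mul (Algebra.norm F), h5]
    simp only [b]
    congr 1
    have := u.2.ne_zero
    have := w.2.ne_zero
    have := (Algebra.norm_ne_zero_iff (R := F)).2 (hne τ)
    field_simp
  have hmain := card_image_le_factorial_of_prod_sub_eq a ha b (W.image x) hx 1
  rw [hcard, Finset.image_image, Finset.card_image_of_injOn] at hmain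
  · exact hmain
  · intro w hw w' hw' h
    have hadj := (Finset.mem_filter.1 hw).2 u hu
    have hadj' := (Finset.mem_filter.1 hw').2 u hu
    refine hadj.snd_eq hadj' ?_
    have h1 : Y w = Y w' := h
    exact add_left_injective _ (inv_injective h1)

variable (F K) in
open Classical in
theorem card_norm_eq_one_mul :
    (Finset.univ.filter fun z : K => Algebra.norm F z = 1).card * (Fintype.card F - 1) =
      Fintype.card K - 1 := by
  have h1 : (Finset.univ.filter fun z : K => z ≠ 0).card = Fintype.card K - 1 := by
    rw [Finset.filter_ne', Finset.card_erase_of_mem (Finset.mem_univ _), Finset.card_univ]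
  have h2 : Fintype.card F - 1 = Fintype.card Fˣ := (Fintype.card_units F).symm
  rw [← h1, h2, mul_comm, ← smul_eq_mul, ← Finset.card_univ,
    ← Finset.sum_const]
  rw [← Finset.sum_congr rfl fun c (_ : c ∈ (Finset.univ : Finset Fˣ)) =>
    card_norm_eq (K := K) c, ← Finset.card_biUnion]
  · congr 1
    ext z
    simp only [Finset.mem_biUnion, Finset.mem_univ, true_and, Finset.mem_filter]
    constructor
    · rintro ⟨c, hc⟩ rfl
      rw [Algebra.norm_zero] at hc
      exact c.ne_zero hc.symm
    · intro hz
      exact ⟨Units.mk0 _ ((Algebra.norm_ne_zero_iff (R := F)).2 hz), rfl⟩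
  · intro c _ c' _ hcc
    refine Finset.disjoint_left.2 fun z hz hz' => hcc ?_
    rw [Finset.mem_filter] at hz hz'
    exact Units.ext (hz.2.symm.trans hz'.2)

open Classical in
theorem card_normAdj (v : K × Fˣ) :
    (Finset.univ.filter fun x => normAdj v x).card = Fintype.card K - 1 := by
  have h1 : (Finset.univ.filter fun z : K => z ≠ -v.1).card = Fintype.card K - 1 := by
    rw [Finset.filter_ne', Finset.card_erase_of_mem (Finset.mem_univ _), Finset.card_univ]
  rw [← h1]
  refine Finset.card_bij (fun x _ => x.1) ?_ ?_ ?_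
  · intro x hx
    simp only [Finset.mem_filter, Finset.mem_univ, true_and] at hx ⊢
    intro h
    exact hx.add_ne_zero (by rw [h]; ring)
  · intro x hx x' hx' h
    simp only [Finset.mem_filter, Finset.mem_univ, true_and] at hx hx'
    exact hx.snd_eq hx' h
  · intro z hz
    simp only [Finset.mem_filter, Finset.mem_univ, true_and] at hz
    have hne : v.1 + z ≠ 0 := fun h => hz (by linear_combination h)
    refine ⟨(z, Units.mk0 _ ((Algebra.norm_ne_zero_iff (R := F)).2 hne) / v.2), ?_, rfl⟩
    rw [Finset.mem_filter, normAdj]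
    refine ⟨Finset.mem_univ _, ?_⟩
    rw [Units.val_div_eq_div_val, Units.val_mk0, mul_div_cancel₀ _ v.2.ne_zero]

-- The ratio `z = (v.1 + x.1) / (w.1 + x.1)` has norm `v.2 / w.2` and is not `1`; conversely any
-- such `z` recovers `x`. The excluded value `1` has the required norm exactly when `v.2 = w.2`.
open Classical in
theorem card_codegree_of_fst_ne {v w : K × Fˣ} (h : v.1 ≠ w.1) :
    (Finset.univ.filter fun x => normAdj v x ∧ normAdj w x).card + (if v.2 = w.2 then 1 else 0) =
      (Finset.univ.filter fun z : K => Algebra.norm F z = 1).card := by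
  have hvw : v.1 - w.1 ≠ 0 := sub_ne_zero.2 h
  have h1 : (Finset.univ.filter fun x => normAdj v x ∧ normAdj w x).card =
      ((Finset.univ.filter fun z : K => Algebra.norm F z = (v.2 / w.2 : Fˣ)).erase 1).card := by
    refine Finset.card_bij (fun x _ => (v.1 + x.1) / (w.1 + x.1)) ?_ ?_ ?_
    · intro x hx
      simp only [Finset.mem_filter, Finset.mem_univ, true_and, Finset.mem_erase] at hx ⊢
      have hne := hx.2.add_ne_zero
      have h2 := hx.1
      have h3 := hx.2
      rw [normAdj] at h2 h3
      constructor
      · rw [ne_eq, div_eq_one_iff_eq hne]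
        exact fun h' => h (add_right_cancel h')
      · rw [div_eq_mul_inv, map_mul, Algebra.norm_inv_field, h2, h3, ← div_eq_mul_inv,
          Units.val_div_eq_div_val, mul_div_mul_right _ _ x.2.ne_zero]
    · intro x hx x' hx' hxx
      simp only [Finset.mem_filter, Finset.mem_univ, true_and] at hx hx'
      have hne := hx.2.add_ne_zero
      have hne' := hx'.2.add_ne_zero
      refine hx.1.snd_eq hx'.1 ?_
      rw [div_eq_div_iff hne hne'] at hxx
      have : (v.1 - w.1) * (x.1 - x'.1) = 0 := by linear_combination -hxx
      exact sub_eq_zero.1 ((mul_eq_zero.1 this).resolve_left hvw)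
    · intro z hz
      simp only [Finset.mem_filter, Finset.mem_univ, true_and, Finset.mem_erase] at hz
      have hz1 : z - 1 ≠ 0 := sub_ne_zero.2 hz.1
      let X : K := (v.1 - w.1) / (z - 1) - w.1
      have hwX : w.1 + X = (v.1 - w.1) / (z - 1) := by simp [X]
      have hwX0 : w.1 + X ≠ 0 := by rw [hwX]; exact div_ne_zero hvw hz1
      have hvX : v.1 + X = z * (w.1 + X) := by
        simp only [X]
        field_simp
        ring
      refine ⟨(X, Units.mk0 _ ((Algebra.norm_ne_zero_iff (R := F)).2 hwX0) / w.2), ?_, ?_⟩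
      · rw [Finset.mem_filter, normAdj, normAdj]
        refine ⟨Finset.mem_univ _, ?_⟩
        rw [Units.val_div_eq_div_val, Units.val_mk0, hvX, map_mul, hz.2,
          Units.val_div_eq_div_val]
        have := w.2.ne_zero
        constructor <;> field_simp
      · simp only
        rw [hvX, mul_div_cancel_right₀ _ hwX0]
  rw [h1, ← card_norm_eq (v.2 / w.2)]
  split_ifs with h2
  · refine Finset.card_erase_add_one ?_
    simp [h2]
  · rw [add_zero, Finset.erase_eq_of_notMem]
    simp only [Finset.mem_filter, Finset.mem_univ, true_and, map_one]
    intro h3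
    exact h2 (div_eq_one.1 (Units.ext h3.symm))

-- A single formula covering equal vertices and equal first coordinates, so that codegrees can be
-- summed over all pairs from a vertex set.
open Classical in
theorem card_codegree (v w : K × Fˣ) :
    ((Finset.univ.filter fun x => normAdj v x ∧ normAdj w x).card : ℝ) =
      (Finset.univ.filter fun z : K => Algebra.norm F z = 1).card -
        (if v.2 = w.2 then 1 else 0) -
        (Finset.univ.filter fun z : K => Algebra.norm F z = 1).card *
          (if v.1 = w.1 then 1 else 0) +
        Fintype.card K * (if v = w then 1 else 0) := by
  by_cases h1 : v.1 = w.1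
  · by_cases h2 : v.2 = w.2
    · have h3 : v = w := Prod.ext h1 h2
      subst h3
      have := card_normAdj v
      simp only [and_self, this, if_true]
      rw [Nat.cast_sub Fintype.card_pos]
      push_cast
      ring
    · have h3 : v ≠ w := fun h => h2 (congrArg Prod.snd h)
      have h4 : (Finset.univ.filter fun x => normAdj v x ∧ normAdj w x) = ∅ := by
        rw [Finset.filter_eq_empty_iff]
        rintro x - ⟨hv, hw⟩
        exact h3 ((normAdj_comm.1 hv).snd_eq (normAdj_comm.1 hw) h1)
      rw [h4]
      simp [h1, h2, h3]
  · have h3 : v ≠ w := fun h => h1 (congrArg Prod.fst h)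
    have := card_codegree_of_fst_ne h1
    rw [← this]
    simp [h1, h3]

open Classical in
/-- The variance of the degree into a vertex set of the projective norm graph. -/
theorem sum_sq_card_normAdj_sub_le (U : Finset (K × Fˣ)) :
    ∑ x : K × Fˣ, (((U.filter fun v => normAdj v x).card : ℝ) -
      (Finset.univ.filter fun z : K => Algebra.norm F z = 1).card / Fintype.card K * U.card) ^ 2 ≤
      Fintype.card K * U.card := by
  set R : ℝ := ((Finset.univ.filter fun z : K => Algebra.norm F z = 1).card : ℝ) with hR
  set Q : ℝ := (Fintype.card K : ℝ) with hQ
  set u : ℝ := (U.card : ℝ) with hu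
  have hQ0 : 0 < Q := Nat.cast_pos.2 Fintype.card_pos
  have hR0 : 0 ≤ R := Nat.cast_nonneg _
  let d : K × Fˣ → ℝ := fun x => ((U.filter fun v => normAdj v x).card : ℝ)
  have hd : ∀ x, d x = ∑ v ∈ U, if normAdj v x then (1 : ℝ) else 0 := fun x => by
    simp [d]
  -- Consequently `R / Q` is exactly the density with loops counted: the degree `Q - 1` over the `Q
  -- * (card F - 1)` vertices.
  have hRQ : R * (Fintype.card F - 1 : ℝ) = Q - 1 := by
    have := card_norm_eq_one_mul F K
    have h1 := congrArg (Nat.cast (R := ℝ)) this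
    rwa [Nat.cast_mul, Nat.cast_sub Fintype.card_pos, Nat.cast_sub Fintype.card_pos,
      Nat.cast_one] at h1
  have hsum1 : ∑ x, d x = u * (Q - 1) := by
    simp_rw [hd]
    rw [Finset.sum_comm]
    have : ∀ v ∈ U, ∑ x : K × Fˣ, (if normAdj v x then (1 : ℝ) else 0) = Q - 1 := by
      intro v _
      rw [Finset.sum_boole, card_normAdj, Nat.cast_sub Fintype.card_pos, Nat.cast_one]
    rw [Finset.sum_congr rfl this, Finset.sum_const, nsmul_eq_mul]
  have hsum2 : ∑ x, d x ^ 2 = R * u ^ 2 - (∑ v ∈ U, ∑ w ∈ U, if v.2 = w.2 then (1 : ℝ) else 0)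
      - R * (∑ v ∈ U, ∑ w ∈ U, if v.1 = w.1 then (1 : ℝ) else 0) + Q * u := by
    have h1 : ∀ x, d x ^ 2 = ∑ v ∈ U, ∑ w ∈ U,
        if normAdj v x ∧ normAdj w x then (1 : ℝ) else 0 := by
      intro x
      rw [sq, hd, Finset.sum_mul_sum]
      refine Finset.sum_congr rfl fun v _ => Finset.sum_congr rfl fun w _ => ?_
      by_cases h1 : normAdj v x <;> by_cases h2 : normAdj w x <;> simp [h1, h2]
    simp_rw [h1]
    rw [Finset.sum_comm.trans (Finset.sum_congr rfl fun v _ => Finset.sum_comm)]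
    have h3 : ∀ v w : K × Fˣ, ∑ x, (if normAdj v x ∧ normAdj w x then (1 : ℝ) else 0) =
        R - (if v.2 = w.2 then 1 else 0) - R * (if v.1 = w.1 then 1 else 0) +
          Q * (if v = w then 1 else 0) := by
      intro v w
      rw [Finset.sum_boole, ← card_codegree]
    simp_rw [h3]
    simp only [Finset.sum_add_distrib, Finset.sum_sub_distrib, Finset.sum_const, nsmul_eq_mul,
      ← Finset.mul_sum]
    have h2 : ∑ v ∈ U, ∑ w ∈ U, (if v = w then (1 : ℝ) else 0) = u := by
      have : ∀ v ∈ U, ∑ w ∈ U, (if v = w then (1 : ℝ) else 0) = 1 := fun v hv => by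
        simp [hv]
      rw [Finset.sum_congr rfl this]
      simp [hu]
    rw [h2]
    ring
  -- Cauchy–Schwarz over the fibres of the first coordinate: the loss `R * P` from pairs in a common
  -- fibre absorbs the excess `R / Q * u ^ 2` of the main terms.
  have hcs : u ^ 2 ≤ Q * (∑ v ∈ U, ∑ w ∈ U, if v.1 = w.1 then (1 : ℝ) else 0) := by
    have h1 : u = ∑ k : K, ((U.filter fun v => v.1 = k).card : ℝ) := by
      rw [hu, Finset.card_eq_sum_card_fiberwise (f := Prod.fst) (t := Finset.univ)
        (fun _ _ => Finset.mem_coe.2 (Finset.mem_univ _))]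
      push_cast
      rfl
    have h2 : ∑ v ∈ U, ∑ w ∈ U, (if v.1 = w.1 then (1 : ℝ) else 0) =
        ∑ k : K, ((U.filter fun v => v.1 = k).card : ℝ) ^ 2 := by
      have h3 : ∀ k : K, ((U.filter fun v => v.1 = k).card : ℝ) ^ 2 =
          ∑ v ∈ U, ∑ w ∈ U, if v.1 = k ∧ w.1 = k then (1 : ℝ) else 0 := by
        intro k
        rw [sq, ← Finset.sum_boole, Finset.sum_mul_sum]
        refine Finset.sum_congr rfl fun v _ => Finset.sum_congr rfl fun w _ => ?_
        by_cases h1 : v.1 = k <;> by_cases h2 : w.1 = k <;> simp [h1, h2]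
      simp_rw [h3]
      rw [Finset.sum_comm.trans (Finset.sum_congr rfl fun v _ => Finset.sum_comm)]
      refine Finset.sum_congr rfl fun v _ => Finset.sum_congr rfl fun w _ => ?_
      by_cases h : v.1 = w.1
      · simp [h]
      · have : ∀ k, ¬ (v.1 = k ∧ w.1 = k) := fun k hk => h (hk.1.trans hk.2.symm)
        simp [h, this]
    rw [h2, h1, hQ]
    exact sq_sum_le_card_mul_sum_sq
  have hpos : 0 ≤ ∑ v ∈ U, ∑ w ∈ U, if v.2 = w.2 then (1 : ℝ) else 0 :=
    Finset.sum_nonneg fun v _ => Finset.sum_nonneg fun w _ => by split_ifs <;> norm_num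
  have hexp : ∑ x, (d x - R / Q * u) ^ 2 =
      ∑ x, d x ^ 2 - 2 * (R / Q * u) * ∑ x, d x + (Q * (Fintype.card F - 1)) * (R / Q * u) ^ 2 := by
    have h1 : (Q * (Fintype.card F - 1) : ℝ) = Fintype.card (K × Fˣ) := by
      rw [Fintype.card_prod, Fintype.card_units, Nat.cast_mul, Nat.cast_sub Fintype.card_pos,
        Nat.cast_one]
    rw [h1, ← nsmul_eq_mul, ← Finset.card_univ, ← Finset.sum_const, Finset.mul_sum,
      ← Finset.sum_sub_distrib, ← Finset.sum_add_distrib]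
    exact Finset.sum_congr rfl fun x _ => by ring
  change ∑ x, (d x - R / Q * u) ^ 2 ≤ Q * u
  rw [hexp, hsum1, hsum2]
  set P := ∑ v ∈ U, ∑ w ∈ U, if v.1 = w.1 then (1 : ℝ) else 0
  have h5 : (Q * (Fintype.card F - 1) : ℝ) * (R / Q * u) ^ 2 = R / Q * u ^ 2 * (Q - 1) := by
    rw [← hRQ]
    field_simp
  rw [h5]
  have h6 : R / Q * u ^ 2 ≤ R * P := by
    rw [div_mul_eq_mul_div, div_le_iff₀ hQ0]
    calc R * u ^ 2 ≤ R * (Q * P) := mul_le_mul_of_nonneg_left hcs hR0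
      _ = _ := by ring
  have h7 : R / Q * u ^ 2 * Q = R * u ^ 2 := by field_simp
  nlinarith

end ProjectiveNormGraph

/-! ### Counting cliques, and biclique-freeness -/

section CliqueCount

variable {V W : Type*}

open Classical in
/-- The number of cliques of size `m` inside the vertex set `U`. -/
noncomputable def cliqueCount (G : SimpleGraph V) (m : ℕ) (U : Finset V) : ℕ :=
  ((U.powersetCard m).filter fun S : Finset V => G.IsClique (S : Set V)).card

theorem cliqueCount_one (G : SimpleGraph V) (U : Finset V) : cliqueCount G 1 U = U.card := by
  classical
  rw [cliqueCount, Finset.filter_true_of_mem, Finset.card_powersetCard, Nat.choose_one_right]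
  intro S hS
  obtain ⟨a, rfl⟩ := Finset.card_eq_one.1 (Finset.mem_powersetCard.1 hS).2
  simp

-- Double counting of pairs of a clique and one of its vertices; removing the vertex leaves a clique
-- in its neighbourhood.
open Classical in
theorem succ_mul_cliqueCount (G : SimpleGraph V) (m : ℕ) (U : Finset V) :
    (m + 1) * cliqueCount G (m + 1) U =
      ∑ v ∈ U, cliqueCount G m (U.filter fun w => G.Adj v w) := by
  have h1 : (m + 1) * cliqueCount G (m + 1) U =
      ∑ S ∈ (U.powersetCard (m + 1)).filter (fun S : Finset V => G.IsClique (S : Set V)),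
        ∑ v ∈ U, if v ∈ S then 1 else 0 := by
    rw [cliqueCount, mul_comm, ← smul_eq_mul, ← Finset.sum_const]
    refine Finset.sum_congr rfl fun S hS => ?_
    obtain ⟨hSU, hSc⟩ := Finset.mem_powersetCard.1 (Finset.mem_filter.1 hS).1
    rw [Finset.sum_boole, Finset.filter_mem_eq_inter, Finset.inter_eq_right.2 hSU, hSc, Nat.cast_id]
  rw [h1, Finset.sum_comm]
  refine Finset.sum_congr rfl fun v hv => ?_
  rw [Finset.sum_boole, Nat.cast_id, cliqueCount]
  refine Finset.card_nbij' (fun S => S.erase v) (fun S => insert v S) ?_ ?_ ?_ ?_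
  · intro S hS
    simp only [Finset.coe_filter, Finset.mem_filter, Finset.mem_powersetCard,
      Set.mem_ofPred_eq] at hS ⊢
    obtain ⟨⟨⟨hSU, hSc⟩, hcl⟩, hvS⟩ := hS
    refine ⟨⟨fun w hw => ?_, ?_⟩, ?_⟩
    · obtain ⟨hne, hw⟩ := Finset.mem_erase.1 hw
      exact Finset.mem_filter.2 ⟨hSU hw, hcl hvS hw hne.symm⟩
    · rw [Finset.card_erase_of_mem hvS, hSc, Nat.add_sub_cancel]
    · exact hcl.subset (Finset.coe_subset.2 (Finset.erase_subset _ _))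
  · intro S hS
    simp only [Finset.coe_filter, Finset.mem_filter, Finset.mem_powersetCard,
      Set.mem_ofPred_eq] at hS ⊢
    obtain ⟨⟨hSU, hSc⟩, hcl⟩ := hS
    have hvS : v ∉ S := fun h => G.loopless.irrefl v (Finset.mem_filter.1 (hSU h)).2
    refine ⟨⟨⟨?_, ?_⟩, ?_⟩, Finset.mem_insert_self _ _⟩
    · exact Finset.insert_subset hv (hSU.trans (Finset.filter_subset _ _))
    · rw [Finset.card_insert_of_notMem hvS, hSc]
    · rw [Finset.coe_insert, SimpleGraph.isClique_insert]
      exact ⟨hcl, fun w hw _ => (Finset.mem_filter.1 (hSU hw)).2⟩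
  · intro S hS
    exact Finset.insert_erase (Finset.mem_filter.1 hS).2
  · intro S hS
    refine Finset.erase_insert fun h => ?_
    have hSU := (Finset.mem_powersetCard.1 (Finset.mem_filter.1 hS).1).1
    exact G.loopless.irrefl v (Finset.mem_filter.1 (hSU h)).2

theorem cliqueCount_le_map (G : SimpleGraph V) (f : V ↪ W) (m : ℕ) (U : Finset V) :
    cliqueCount G m U ≤ cliqueCount (G.map f) m (U.map f) := by
  classical
  refine Finset.card_le_card_of_injOn (fun S => S.map f) ?_ ?_
  · intro S hS
    simp only [Finset.coe_filter, Finset.mem_powersetCard, Set.mem_ofPred_eq] at hS ⊢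
    refine ⟨⟨Finset.map_subset_map.2 hS.1.1, by rw [Finset.card_map, hS.1.2]⟩, ?_⟩
    rw [Finset.coe_map]
    exact hS.2.map
  · intro S _ S' _ h
    exact Finset.map_injective f h

theorem cliqueCount_mono_right (G : SimpleGraph V) (m : ℕ) {U U' : Finset V} (h : U ⊆ U') :
    cliqueCount G m U ≤ cliqueCount G m U' := by
  classical
  exact Finset.card_le_card (Finset.filter_subset_filter _ (Finset.powersetCard_mono h))

/-- A complete subgraph is determined by its vertex set. -/
theorem copyCount_completeGraph [Fintype V] (G : SimpleGraph V) (m : ℕ) :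
    G.copyCount (SimpleGraph.completeGraph (Fin m)) = cliqueCount G m Finset.univ := by
  classical
  rw [SimpleGraph.copyCount, cliqueCount]
  have hadj : ∀ G' : G.Subgraph, Nonempty (SimpleGraph.completeGraph (Fin m) ≃g G'.coe) →
      ∀ a b, G'.Adj a b ↔ a ∈ G'.verts ∧ b ∈ G'.verts ∧ a ≠ b := by
    rintro G' ⟨e⟩ a b
    constructor
    · intro h
      exact ⟨G'.edge_vert h, G'.edge_vert h.symm, h.ne⟩
    · rintro ⟨ha, hb, hab⟩
      have h1 : G'.coe.Adj (e (e.symm ⟨a, ha⟩)) (e (e.symm ⟨b, hb⟩)) := by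
        rw [e.map_adj_iff]
        intro h
        exact hab (congrArg Subtype.val (e.symm.injective h))
      simpa using h1
  refine Finset.card_bij (fun G' _ => G'.verts.toFinset) ?_ ?_ ?_
  · intro G' hG'
    have hG' := (Finset.mem_filter.1 hG').2
    have h1 := hadj G' hG'
    obtain ⟨e⟩ := hG'
    simp only [Finset.mem_filter, Finset.mem_powersetCard, Finset.subset_univ, true_and,
      Set.coe_toFinset]
    refine ⟨?_, fun a ha b hb hab => G'.adj_sub ((h1 a b).2 ⟨ha, hb, hab⟩)⟩
    rw [Set.toFinset_card, ← Fintype.card_congr e.toEquiv, Fintype.card_fin]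
  · intro G' hG' G'' hG'' h
    have h1 := hadj G' (Finset.mem_filter.1 hG').2
    have h2 := hadj G'' (Finset.mem_filter.1 hG'').2
    have h3 : G'.verts = G''.verts := Set.toFinset_inj.1 h
    ext a b
    · rw [h3]
    · rw [h1, h2, h3]
  · intro S hS
    simp only [Finset.mem_filter, Finset.mem_powersetCard, Finset.subset_univ, true_and] at hS
    refine ⟨(⊤ : G.Subgraph).induce S, ?_, by simp⟩
    simp only [Finset.mem_filter, Finset.mem_univ, true_and]
    have e : Fin m ≃ ((⊤ : G.Subgraph).induce (S : Set V)).verts :=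
      (Fintype.equivFinOfCardEq (α := (S : Set V)) (by simpa using hS.1)).symm
    refine ⟨⟨e, ?_⟩⟩
    intro i j
    simp only [SimpleGraph.Subgraph.coe_adj, SimpleGraph.Subgraph.induce_adj,
      SimpleGraph.Subgraph.top_adj, SimpleGraph.completeGraph, SimpleGraph.top_adj]
    constructor
    · rintro ⟨_, _, h⟩ rfl
      exact G.loopless.irrefl _ h
    · intro h
      exact ⟨(e i).2, (e j).2, hS.2 (e i).2 (e j).2 fun h' => h (e.injective (Subtype.ext h'))⟩

open Classical in
/-- A graph in which every `s` vertices have fewer than `t` common neighbours is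
`K_{s,t}`-free. -/
theorem free_completeBipartiteGraph [Fintype V] (G : SimpleGraph V) {s t : ℕ}
    (h : ∀ S : Finset V, S.card = s →
      (Finset.univ.filter fun w => ∀ v ∈ S, G.Adj v w).card < t) :
    (completeBipartiteGraph (Fin s) (Fin t)).Free G := by
  rintro ⟨c⟩
  let S : Finset V := Finset.univ.image fun i => c (Sum.inl i)
  have hS : S.card = s := by
    rw [Finset.card_image_of_injective, Finset.card_univ, Fintype.card_fin]
    exact c.injective.comp Sum.inl_injective
  have hT : (Finset.univ.image fun j => c (Sum.inr j)).card = t := by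
    rw [Finset.card_image_of_injective, Finset.card_univ, Fintype.card_fin]
    exact c.injective.comp Sum.inr_injective
  refine (h S hS).not_ge ?_
  rw [← hT]
  refine Finset.card_le_card fun w hw => ?_
  obtain ⟨j, -, rfl⟩ := Finset.mem_image.1 hw
  refine Finset.mem_filter.2 ⟨Finset.mem_univ _, fun v hv => ?_⟩
  obtain ⟨i, -, rfl⟩ := Finset.mem_image.1 hv
  exact c.toHom.map_adj (by simp)

open Classical in
theorem card_commonNeighbors_lt_of_free [Fintype V] (G : SimpleGraph V) {s t : ℕ}
    (h : (completeBipartiteGraph (Fin s) (Fin t)).Free G) (S : Finset V) (hS : S.card = s) :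
    (Finset.univ.filter fun w => ∀ v ∈ S, G.Adj v w).card < t := by
  by_contra! hlt
  obtain ⟨T, hT, hTc⟩ := Finset.exists_subset_card_eq hlt
  apply h
  have e₁ : Fin s ≃ S := (Fintype.equivFinOfCardEq (by simpa using hS)).symm
  have e₂ : Fin t ≃ T := (Fintype.equivFinOfCardEq (by simpa using hTc)).symm
  have hadj : ∀ v ∈ S, ∀ w ∈ T, G.Adj v w := fun v hv w hw => (Finset.mem_filter.1 (hT hw)).2 v hv
  refine ⟨⟨⟨Sum.elim (fun i => (e₁ i : V)) (fun j => (e₂ j : V)), ?_⟩, ?_⟩⟩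
  · rintro (i | i) (j | j) hij
    · simp at hij
    · exact hadj _ (e₁ i).2 _ (e₂ j).2
    · exact (hadj _ (e₁ j).2 _ (e₂ i).2).symm
    · simp at hij
  · rintro (i | i) (j | j) hij
    · exact congrArg _ (e₁.injective (Subtype.ext hij))
    · have := hadj _ (e₁ i).2 _ (e₂ j).2
      exact absurd hij this.ne
    · have := hadj _ (e₁ j).2 _ (e₂ i).2
      exact absurd hij.symm this.ne
    · exact congrArg _ (e₂.injective (Subtype.ext hij))

/-- Every vertex of `K_{s,t}` has a neighbour since both sides are nonempty, so a copy cannot use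
the isolated vertices outside the range of `f`. -/
theorem free_map {s t : ℕ} (hs : 0 < s) (ht : 0 < t) (G : SimpleGraph V) (f : V ↪ W)
    (h : (completeBipartiteGraph (Fin s) (Fin t)).Free G) :
    (completeBipartiteGraph (Fin s) (Fin t)).Free (G.map f) := by
  rintro ⟨c⟩
  have hex : ∀ x, ∃ v, f v = c x := by
    have key : ∀ x y, (completeBipartiteGraph (Fin s) (Fin t)).Adj x y → ∃ v, f v = c x := by
      intro x y hxy
      obtain ⟨v, w, -, hv, -⟩ := (SimpleGraph.map_adj f G _ _).1 (c.toHom.map_adj hxy)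
      exact ⟨v, hv⟩
    rintro (i | j)
    · exact key _ (Sum.inr ⟨0, ht⟩) (by simp)
    · exact key _ (Sum.inl ⟨0, hs⟩) (by simp)
  choose g hg using hex
  refine h ⟨⟨⟨g, fun {x y} hxy => ?_⟩, fun x y hxy => ?_⟩⟩
  · have := c.toHom.map_adj hxy
    rw [SimpleGraph.Copy.toHom_apply, SimpleGraph.Copy.toHom_apply, ← hg, ← hg] at this
    exact SimpleGraph.map_adj_apply.1 this
  · have h1 : g x = g y := hxy
    have h2 : c x = c y := by rw [← hg, ← hg, h1]
    exact c.injective h2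

theorem cliqueCount_le_exCliqueBiclique [Fintype V] (G : SimpleGraph V) {n s t : ℕ} (m : ℕ)
    (hs : 0 < s) (ht : 0 < t) (hn : Fintype.card V ≤ n)
    (h : (completeBipartiteGraph (Fin s) (Fin t)).Free G) (U : Finset V) :
    cliqueCount G m U ≤ exCliqueBiclique n m s t := by
  classical
  obtain ⟨f⟩ : Nonempty (V ↪ Fin n) :=
    Function.Embedding.nonempty_of_card_le (by simpa using hn)
  calc cliqueCount G m U ≤ cliqueCount (G.map f) m (U.map f) := cliqueCount_le_map G f m U
    _ ≤ cliqueCount (G.map f) m Finset.univ := cliqueCount_mono_right _ _ (Finset.subset_univ _)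
    _ = (G.map f).copyCount (SimpleGraph.completeGraph (Fin m)) :=
        (copyCount_completeGraph _ _).symm
    _ ≤ _ := by
        unfold exCliqueBiclique genExtremalNumber
        refine Finset.le_sup (f := fun G : SimpleGraph (Fin n) =>
          G.copyCount (SimpleGraph.completeGraph (Fin m))) ?_
        rw [Finset.mem_filter]
        exact ⟨Finset.mem_univ _, free_map hs ht G f h⟩

theorem exists_exCliqueBiclique_eq (n m s t : ℕ)
    (h : 0 < exCliqueBiclique n m s t) :
    ∃ G : SimpleGraph (Fin n), (completeBipartiteGraph (Fin s) (Fin t)).Free G ∧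
      exCliqueBiclique n m s t = cliqueCount G m Finset.univ := by
  classical
  unfold exCliqueBiclique genExtremalNumber at h ⊢
  rw [Finset.lt_sup_iff] at h
  obtain ⟨G₀, hG₀, -⟩ := h
  obtain ⟨G, hG, hGe⟩ := Finset.exists_mem_eq_sup _ ⟨G₀, hG₀⟩
    (fun G : SimpleGraph (Fin n) => G.copyCount (SimpleGraph.completeGraph (Fin m)))
  refine ⟨G, (Finset.mem_filter.1 hG).2, ?_⟩
  rw [hGe, copyCount_completeGraph]

open Classical in
/-- Lower bound for the number of cliques in a graph whose degrees into vertex sets have small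
variance. -/
theorem le_factorial_mul_cliqueCount (G : SimpleGraph V) (U₀ : Finset V) {p L δ : ℝ}
    (hp : 0 < p) (hp1 : p ≤ 1) (hδ : 0 < δ) (hδ1 : δ < 1)
    (hvar : ∀ U ⊆ U₀, ∑ v ∈ U, (((U.filter fun w => G.Adj v w).card : ℝ) - p * U.card) ^ 2 ≤
      L * U.card) (m : ℕ) :
    ∀ U ⊆ U₀, (m = 0 ∨ L ≤ δ ^ 3 * p ^ 2 * ((1 - δ) * p) ^ (2 * (m - 1)) * (U.card : ℝ) ^ 2) →
      (1 - δ) ^ ((m + 1) ^ 2) * (U.card : ℝ) ^ (m + 1) * p ^ ((m + 1).choose 2) ≤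
        ((m + 1)! : ℝ) * cliqueCount G (m + 1) U := by
  have hδ' : 0 < 1 - δ := by linarith
  have hδ'' : 1 - δ ≤ 1 := by linarith
  set η := 1 - δ with hη
  induction m with
  | zero =>
    intro U _ _
    rw [cliqueCount_one]
    simp
    exact mul_le_of_le_one_left (Nat.cast_nonneg _) hδ''
  | succ m ih =>
    intro U hU hL
    have hL := hL.resolve_left (Nat.succ_ne_zero m)
    rw [Nat.add_sub_cancel] at hL
    set u : ℝ := (U.card : ℝ) with hu
    rcases eq_or_lt_of_le (Nat.cast_nonneg U.card : (0 : ℝ) ≤ U.card) with h0 | hupos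
    · rw [hu, ← h0, zero_pow (by omega), mul_zero, zero_mul]
      positivity
    rw [← hu] at hupos
    have hηp : η * p ≤ 1 := mul_le_one₀ hδ'' hp.le hp1
    have hηp0 : 0 < η * p := mul_pos hδ' hp
    have hL0 : L ≤ δ ^ 3 * p ^ 2 * u ^ 2 := by
      refine hL.trans ?_
      have : (η * p) ^ (2 * m) ≤ 1 := pow_le_one₀ hηp0.le hηp
      have h1 : 0 ≤ δ ^ 3 * p ^ 2 := by positivity
      have h2 : δ ^ 3 * p ^ 2 * (η * p) ^ (2 * m) ≤ δ ^ 3 * p ^ 2 := mul_le_of_le_one_right h1 this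
      exact mul_le_mul_of_nonneg_right h2 (sq_nonneg u)
    let N : V → Finset V := fun v => U.filter fun w => G.Adj v w
    let A := U.filter fun v => η * p * u ≤ (N v).card
    let B := U.filter fun v => ¬ (η * p * u ≤ (N v).card)
    have hAB : (A.card : ℝ) + B.card = u := by
      rw [hu]
      exact_mod_cast Finset.card_filter_add_card_filter_not _
    -- Chebyshev: each vertex of `B` deviates by at least `δ * p * u`. Two of the three factors `δ`
    -- in the hypothesis pay for the deviation; the third bounds the proportion of exceptional
    -- vertices.
    have hB : (B.card : ℝ) ≤ δ * u := by
      have h1 : (B.card : ℝ) * (δ * p * u) ^ 2 ≤ L * u := by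
        refine le_trans ?_ (hvar U hU)
        rw [← nsmul_eq_mul, ← Finset.sum_const]
        refine le_trans (Finset.sum_le_sum fun v hv => ?_)
          (Finset.sum_le_sum_of_subset_of_nonneg (Finset.filter_subset _ _)
            fun v _ _ => sq_nonneg _)
        have h2 := (Finset.mem_filter.1 hv).2
        push Not at h2
        have h3 : δ * p * u ≤ p * u - (N v).card := by
          have : η * p * u = p * u - δ * p * u := by rw [hη]; ring
          linarith
        have h4 : 0 ≤ δ * p * u := by positivity
        calc (δ * p * u) ^ 2 ≤ (p * u - (N v).card) ^ 2 := by gcongr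
          _ = _ := sub_sq_comm _ _
      have h5 : (B.card : ℝ) * (δ * p * u) ^ 2 ≤ (δ * u) * (δ * p * u) ^ 2 := by
        refine h1.trans ((mul_le_mul_of_nonneg_right hL0 hupos.le).trans (le_of_eq ?_))
        ring
      exact le_of_mul_le_mul_right h5 (by positivity)
    have hA : η * u ≤ A.card := by
      have : η * u = u - δ * u := by rw [hη]; ring
      linarith
    have hterm : ∀ v ∈ A, η ^ ((m + 1) ^ 2) * (η * p * u) ^ (m + 1) * p ^ ((m + 1).choose 2) ≤
        ((m + 1)! : ℝ) * cliqueCount G (m + 1) (N v) := by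
      intro v hv
      have hv2 := (Finset.mem_filter.1 hv).2
      refine le_trans ?_ (ih (N v) ((Finset.filter_subset _ _).trans hU) ?_)
      · gcongr
      -- Passing to a neighbourhood shrinks the set by a factor of at worst `η * p`, and the
      -- condition for cliques one smaller is weaker by exactly the square of this factor.
      · rcases Nat.eq_zero_or_pos m with h | h
        · exact Or.inl h
        · refine Or.inr (hL.trans ?_)
          calc δ ^ 3 * p ^ 2 * (η * p) ^ (2 * m) * u ^ 2
              = δ ^ 3 * p ^ 2 * (η * p) ^ (2 * (m - 1)) * (η * p * u) ^ 2 := by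
                obtain ⟨k, rfl⟩ : ∃ k, m = k + 1 := ⟨m - 1, by omega⟩
                rw [Nat.add_sub_cancel]
                ring
            _ ≤ _ := by gcongr
    have hrec : ((m + 1 + 1)! : ℝ) * cliqueCount G (m + 1 + 1) U =
        ∑ v ∈ U, ((m + 1)! : ℝ) * cliqueCount G (m + 1) (N v) := by
      rw [← Finset.mul_sum, Nat.factorial_succ]
      have := congrArg (Nat.cast (R := ℝ)) (succ_mul_cliqueCount G (m + 1) U)
      push_cast at this ⊢
      rw [← this]
      ring
    rw [hrec]
    calc η ^ ((m + 1 + 1) ^ 2) * u ^ (m + 1 + 1) * p ^ ((m + 1 + 1).choose 2)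
        ≤ η ^ (1 + (m + 1) ^ 2 + (m + 1)) * u ^ (m + 1 + 1) * p ^ ((m + 1 + 1).choose 2) := by
          have := pow_le_pow_of_le_one hδ'.le hδ''
            (show 1 + (m + 1) ^ 2 + (m + 1) ≤ (m + 1 + 1) ^ 2 by nlinarith)
          gcongr
      _ = (η * u) * (η ^ ((m + 1) ^ 2) * (η * p * u) ^ (m + 1) * p ^ ((m + 1).choose 2)) := by
          have hch : (m + 1 + 1).choose 2 = (m + 1) + (m + 1).choose 2 := by
            rw [Nat.choose_succ_succ' (m + 1) 1, Nat.choose_one_right]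
          rw [hch, pow_add p]
          ring_nf
      _ ≤ A.card * (η ^ ((m + 1) ^ 2) * (η * p * u) ^ (m + 1) * p ^ ((m + 1).choose 2)) := by
          gcongr
      _ = ∑ v ∈ A, η ^ ((m + 1) ^ 2) * (η * p * u) ^ (m + 1) * p ^ ((m + 1).choose 2) := by
          rw [Finset.sum_const, nsmul_eq_mul]
      _ ≤ ∑ v ∈ A, ((m + 1)! : ℝ) * cliqueCount G (m + 1) (N v) := Finset.sum_le_sum hterm
      _ ≤ _ := Finset.sum_le_sum_of_subset_of_nonneg (Finset.filter_subset _ _)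
          fun v _ _ => by positivity

end CliqueCount

/-! ### The upper bound: stars and power means -/

section UpperBound

variable {V : Type*}

open Classical in
/-- Every `s` vertices of `U` have fewer than `t` common neighbours in `U`. -/
def BicliqueFreeOn (G : SimpleGraph V) (s t : ℕ) (U : Finset V) : Prop :=
  ∀ S ⊆ U, S.card = s → (U.filter fun w => ∀ v ∈ S, G.Adj v w).card < t

-- Adjoining `v` to a set inside its neighbourhood loses no common neighbour lying in that
-- neighbourhood.
open Classical in
theorem BicliqueFreeOn.neighbors {G : SimpleGraph V} {s t : ℕ} {U : Finset V}
    (h : BicliqueFreeOn G (s + 1) t U) {v : V} (hv : v ∈ U) :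
    BicliqueFreeOn G s t (U.filter fun w => G.Adj v w) := by
  intro S hS hSc
  have hvS : v ∉ S := fun h => G.loopless.irrefl v (Finset.mem_filter.1 (hS h)).2
  have h1 := h (insert v S)
    (Finset.insert_subset hv (hS.trans (Finset.filter_subset _ _)))
    (by rw [Finset.card_insert_of_notMem hvS, hSc])
  refine lt_of_le_of_lt (Finset.card_le_card fun w hw => ?_) h1
  obtain ⟨hw1, hw2⟩ := Finset.mem_filter.1 hw
  obtain ⟨hw3, hw4⟩ := Finset.mem_filter.1 hw1
  refine Finset.mem_filter.2 ⟨hw3, fun x hx => ?_⟩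
  rcases Finset.mem_insert.1 hx with rfl | hx
  · exact hw4
  · exact hw2 x hx

open Classical in
/-- Counting stars `K_{1,s}`. -/
theorem BicliqueFreeOn.sum_pow_le {G : SimpleGraph V} {s t : ℕ} {U : Finset V}
    (h : BicliqueFreeOn G s t U) :
    ∑ v ∈ U, ((U.filter fun w => G.Adj v w).card + 1 - s) ^ s ≤ (t - 1) * U.card ^ s := by
  -- Both sides count pairs of a vertex and an `s`-set inside its neighbourhood.
  have h1 : ∑ v ∈ U, ((U.filter fun w => G.Adj v w).card.choose s) =
      ∑ S ∈ U.powersetCard s, (U.filter fun w => ∀ v ∈ S, G.Adj v w).card := by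
    have h2 : ∀ v ∈ U, (U.filter fun w => G.Adj v w).card.choose s =
        ∑ S ∈ U.powersetCard s, if ∀ w ∈ S, G.Adj w v then 1 else 0 := by
      intro v _
      rw [Finset.sum_boole, Nat.cast_id, ← Finset.card_powersetCard]
      congr 1
      ext S
      simp only [Finset.mem_powersetCard, Finset.mem_filter, Finset.subset_iff]
      constructor
      · rintro ⟨h1, h2⟩
        exact ⟨⟨fun w hw => (h1 hw).1, h2⟩, fun w hw => (h1 hw).2.symm⟩
      · rintro ⟨⟨h1, h2⟩, h3⟩
        exact ⟨fun w hw => ⟨h1 hw, (h3 w hw).symm⟩, h2⟩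
    rw [Finset.sum_congr rfl h2, Finset.sum_comm]
    refine Finset.sum_congr rfl fun S _ => ?_
    rw [Finset.sum_boole, Nat.cast_id]
  calc ∑ v ∈ U, ((U.filter fun w => G.Adj v w).card + 1 - s) ^ s
      ≤ ∑ v ∈ U, s ! * ((U.filter fun w => G.Adj v w).card.choose s) := by
        refine Finset.sum_le_sum fun v _ => ?_
        rw [← Nat.descFactorial_eq_factorial_mul_choose]
        exact Nat.pow_sub_le_descFactorial _ _
    _ = s ! * ∑ S ∈ U.powersetCard s, (U.filter fun w => ∀ v ∈ S, G.Adj v w).card := by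
        rw [← Finset.mul_sum, h1]
    _ ≤ s ! * ∑ S ∈ U.powersetCard s, (t - 1) := by
        refine Nat.mul_le_mul_left _ (Finset.sum_le_sum fun S hS => ?_)
        obtain ⟨hS1, hS2⟩ := Finset.mem_powersetCard.1 hS
        exact Nat.le_sub_one_of_lt (h S hS1 hS2)
    _ = (t - 1) * U.card.descFactorial s := by
        rw [Finset.sum_const, Finset.card_powersetCard, smul_eq_mul,
          Nat.descFactorial_eq_factorial_mul_choose]
        ring
    _ ≤ _ := Nat.mul_le_mul_left _ (Nat.descFactorial_le_pow _ _)

/-- The power mean inequality with exponent `s / α ≥ 1`, applied to the `e i ^ α`. -/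
theorem sum_rpow_le_card_rpow_mul {ι : Type*} (U : Finset ι) (e : ι → ℝ) (he : ∀ i, 0 ≤ e i)
    {α s : ℝ} (hα : 0 < α) (hαs : α ≤ s) :
    ∑ i ∈ U, e i ^ α ≤ (U.card : ℝ) ^ (1 - α / s) * (∑ i ∈ U, e i ^ s) ^ (α / s) := by
  have hs : 0 < s := hα.trans_le hαs
  have hp : 1 ≤ s / α := (one_le_div hα).2 hαs
  have h := Real.rpow_sum_le_const_mul_sum_rpow U (fun i => e i ^ α) hp
  have h1 : ∀ i, |e i ^ α| = e i ^ α := fun i => abs_of_nonneg (Real.rpow_nonneg (he i) _)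
  have h2 : ∀ i, (e i ^ α) ^ (s / α) = e i ^ s := fun i => by
    rw [← Real.rpow_mul (he i), mul_div_cancel₀ _ hα.ne']
  simp only [h1, h2] at h
  have hnn : 0 ≤ ∑ i ∈ U, e i ^ α := Finset.sum_nonneg fun i _ => Real.rpow_nonneg (he i) _
  have hnn' : 0 ≤ ∑ i ∈ U, e i ^ s := Finset.sum_nonneg fun i _ => Real.rpow_nonneg (he i) _
  have h3 := Real.rpow_le_rpow (Real.rpow_nonneg hnn _) h (by positivity : 0 ≤ α / s)
  rw [← Real.rpow_mul hnn, div_mul_div_cancel₀ hα.ne', div_self hs.ne', Real.rpow_one,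
    Real.mul_rpow (by positivity) hnn', ← Real.rpow_mul (Nat.cast_nonneg _)] at h3
  have h4 : (s / α - 1) * (α / s) = 1 - α / s := by field_simp
  rwa [h4] at h3

/-- Star counting controls only shifted degrees. The shift costs a factor close to `1` for large
`d`, and a constant for the rest. -/
theorem exists_rpow_le_mul_rpow_sub_add {α : ℝ} (hα : 0 < α) (c : ℕ) {ε : ℝ} (hε : 0 < ε) :
    ∃ C : ℝ, 0 ≤ C ∧ ∀ d : ℕ, (d : ℝ) ^ α ≤ (1 + ε) * ((d - c : ℕ) : ℝ) ^ α + C := by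
  set ρ : ℝ := (1 + ε) ^ (1 / α) with hρ
  have hρ1 : 1 < ρ := Real.one_lt_rpow (by linarith) (by positivity)
  have hρα : ρ ^ α = 1 + ε := by
    rw [hρ, ← Real.rpow_mul (by linarith), one_div_mul_cancel hα.ne', Real.rpow_one]
  set D : ℝ := ρ * c / (ρ - 1) with hD
  have hρ0 : 0 < ρ - 1 := by linarith
  have hD0 : 0 ≤ D := by positivity
  refine ⟨D ^ α, by positivity, fun d => ?_⟩
  rcases le_or_gt (d : ℝ) D with h | h
  · have h1 : (d : ℝ) ^ α ≤ D ^ α := Real.rpow_le_rpow (Nat.cast_nonneg _) h hα.le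
    have h2 : 0 ≤ (1 + ε) * ((d - c : ℕ) : ℝ) ^ α := by positivity
    linarith
  · rw [hD, div_lt_iff₀ hρ0] at h
    have hcd : (c : ℝ) ≤ d := by nlinarith [(Nat.cast_nonneg c : (0 : ℝ) ≤ c)]
    have h1 : (d : ℝ) ≤ ρ * ((d - c : ℕ) : ℝ) := by
      rw [Nat.cast_sub (by exact_mod_cast hcd)]
      nlinarith
    have h2 := Real.rpow_le_rpow (Nat.cast_nonneg _) h1 hα.le
    rw [Real.mul_rpow (by linarith) (Nat.cast_nonneg _), hρα] at h2
    have h3 : 0 ≤ D ^ α := by positivity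
    linarith

theorem exists_mul_le_mul_rpow_add {β B : ℝ} (hβ : 1 < β) (hB : 0 < B) {C : ℝ} (hC : 0 ≤ C) :
    ∃ C' : ℝ, 0 ≤ C' ∧ ∀ u : ℕ, C * u ≤ B * (u : ℝ) ^ β + C' := by
  set U₀ : ℝ := (C / B) ^ (1 / (β - 1)) with hU₀
  have hβ0 : 0 < β - 1 := by linarith
  have hU0 : 0 ≤ U₀ := by positivity
  refine ⟨C * U₀, by positivity, fun u => ?_⟩
  have hu0 : (0 : ℝ) ≤ u := Nat.cast_nonneg _
  rcases le_or_gt (u : ℝ) U₀ with h | h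
  · have h1 : C * u ≤ C * U₀ := mul_le_mul_of_nonneg_left h hC
    have h2 : 0 ≤ B * (u : ℝ) ^ β := by positivity
    linarith
  · have hupos : (0 : ℝ) < u := lt_of_le_of_lt hU0 h
    have h1 := Real.rpow_le_rpow hU0 h.le hβ0.le
    rw [hU₀, ← Real.rpow_mul (by positivity), one_div_mul_cancel hβ0.ne', Real.rpow_one,
      div_le_iff₀ hB] at h1
    have h2 : (u : ℝ) ^ β = (u : ℝ) ^ (β - 1) * u := by
      rw [← Real.rpow_add_one hupos.ne', sub_add_cancel]
    have h3 := mul_le_mul_of_nonneg_right h1 hu0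
    have h4 : 0 ≤ C * U₀ := by positivity
    rw [h2]
    linarith

theorem two_mul_cliqueCount_two_le {G : SimpleGraph V} {t : ℕ} {U : Finset V}
    (h : BicliqueFreeOn G 1 t U) : 2 * cliqueCount G 2 U ≤ (t - 1) * U.card := by
  classical
  have h1 := succ_mul_cliqueCount G 1 U
  simp only [cliqueCount_one] at h1
  calc 2 * cliqueCount G 2 U = _ := h1
    _ ≤ ∑ v ∈ U, (t - 1) := Finset.sum_le_sum fun v hv => by
        have := h {v} (Finset.singleton_subset_iff.2 hv) (Finset.card_singleton v)
        simp only [Finset.mem_singleton, forall_eq] at this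
        exact Nat.le_sub_one_of_lt this
    _ = _ := by rw [Finset.sum_const, smul_eq_mul, mul_comm]

/-- Induction on clique size, with `s` dropping by one in neighbourhoods. The additive constant does
not depend on the graph or on `U`, so the induction hypothesis can be summed over all neighbourhoods
at once. -/
theorem factorial_mul_cliqueCount_le (m : ℕ) :
    ∀ s t : ℕ, m ≤ s → s ≤ t → 1 ≤ t → ∀ ε : ℝ, 0 < ε → ∃ C : ℝ, 0 ≤ C ∧
      ∀ {V : Type} (G : SimpleGraph V) (U : Finset V), BicliqueFreeOn G s t U →
        ((m + 1)! : ℝ) * cliqueCount G (m + 1) U ≤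
          (1 + ε) * ((t : ℝ) - 1) ^ (((m : ℝ) + 1) * m / (2 * s)) *
            (U.card : ℝ) ^ ((m : ℝ) + 1 - ((m : ℝ) + 1) * m / (2 * s)) + C := by
  classical
  induction m with
  | zero =>
    intro s t _ _ _ ε hε
    refine ⟨0, le_rfl, fun {V} G U _ => ?_⟩
    rw [cliqueCount_one]
    simp
    nlinarith [(Nat.cast_nonneg U.card : (0 : ℝ) ≤ U.card)]
  | succ m ih =>
    intro s t hms hst ht ε hε
    obtain ⟨s, rfl⟩ : ∃ k, s = k + 1 := ⟨s - 1, by omega⟩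
    have ht1 : (0 : ℝ) ≤ (t : ℝ) - 1 := by
      have : (1 : ℝ) ≤ t := by exact_mod_cast ht
      linarith
    -- For forbidden `K_{1,t}` the exponent `β` is exactly `1`, so an error linear in `u` could not
    -- be absorbed; here edges are counted directly from the degree bound.
    rcases Nat.eq_zero_or_pos s with rfl | hs
    · obtain rfl : m = 0 := by omega
      refine ⟨0, le_rfl, fun {V} G U h => ?_⟩
      have h1 := two_mul_cliqueCount_two_le h
      have h2 : (2 : ℝ) * cliqueCount G 2 U ≤ ((t : ℝ) - 1) * U.card := by
        have h3 : ((t - 1 : ℕ) : ℝ) = (t : ℝ) - 1 := by rw [Nat.cast_sub ht, Nat.cast_one]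
        rw [← h3]
        exact_mod_cast h1
      norm_num
      have h4 : 0 ≤ ((t : ℝ) - 1) * U.card := by positivity
      nlinarith
    have hs0 : (0 : ℝ) < s := Nat.cast_pos.2 hs
    have hms' : (m : ℝ) ≤ s := by exact_mod_cast (by omega : m ≤ s)
    have hm0 : (0 : ℝ) ≤ m := Nat.cast_nonneg m
    have htpos : (0 : ℝ) < (t : ℝ) - 1 := by
      have : (2 : ℝ) ≤ t := by exact_mod_cast (by omega : 2 ≤ t)
      linarith
    set r : ℝ := (t : ℝ) - 1 with hr
    set α : ℝ := (m : ℝ) + 1 - ((m : ℝ) + 1) * m / (2 * s) with hα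
    set β : ℝ := ((m + 1 : ℕ) : ℝ) + 1 -
      (((m + 1 : ℕ) : ℝ) + 1) * ((m + 1 : ℕ) : ℝ) / (2 * ((s + 1 : ℕ) : ℝ)) with hβ
    set a : ℝ := ((m : ℝ) + 1) * m / (2 * s) with ha
    set b : ℝ := (((m + 1 : ℕ) : ℝ) + 1) * ((m + 1 : ℕ) : ℝ) / (2 * ((s + 1 : ℕ) : ℝ)) with hb
    have ha2 : a ≤ ((m : ℝ) + 1) / 2 := by
      rw [ha, div_le_div_iff₀ (by positivity) two_pos]
      nlinarith
    have hα0 : 0 < α := by linarith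
    have ha0 : 0 ≤ a := by positivity
    have hαs : α ≤ ((s + 1 : ℕ) : ℝ) := by push_cast; linarith
    have hS0 : (0 : ℝ) < ((s + 1 : ℕ) : ℝ) := by positivity
    have hβ1 : 1 < β := by
      have hb2 : b < (m : ℝ) + 1 := by
        rw [hb, div_lt_iff₀ (by positivity)]
        push_cast
        have : (1 : ℝ) ≤ s := by exact_mod_cast hs
        nlinarith
      rw [hβ]
      push_cast
      linarith
    -- This identity and the next close the induction: after the power mean step the exponents of `t
    -- - 1` and of `u` are those claimed one size up.
    have hab : a + α / ((s + 1 : ℕ) : ℝ) = b := by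
      rw [hα, ha, hb]
      push_cast
      field_simp
      ring
    have hαβ : 1 - α / ((s + 1 : ℕ) : ℝ) + α = β := by
      have : β = (m : ℝ) + 1 + 1 - b := by rw [hβ]; push_cast; ring
      rw [this, ← hab]
      rw [hα]
      ring
    set ε₁ : ℝ := min 1 (ε / 4) with hε₁
    have hε₁0 : 0 < ε₁ := by positivity
    have hε₁1 : ε₁ ≤ 1 := min_le_left _ _
    have hε₁2 : ε₁ ≤ ε / 4 := min_le_right _ _
    obtain ⟨C₁, hC₁, h₁⟩ := ih s t (by omega) (by omega) ht ε₁ hε₁0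
    obtain ⟨C₂, hC₂, h₂⟩ := exists_rpow_le_mul_rpow_sub_add hα0 s hε₁0
    -- A bounded error per vertex totals `O(u)`, which is absorbed into the main term because `β >
    -- 1`.
    obtain ⟨C₃, hC₃, h₃⟩ := exists_mul_le_mul_rpow_add hβ1 (B := ε₁ * r ^ b) (by positivity)
      (C := (1 + ε₁) * r ^ a * C₂ + C₁) (by positivity)
    refine ⟨C₃, hC₃, fun {V} G U hfree => ?_⟩
    set u : ℝ := (U.card : ℝ) with hu
    let N : V → Finset V := fun v => U.filter fun w => G.Adj v w
    let e : V → ℝ := fun v => (((N v).card - s : ℕ) : ℝ)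
    have he0 : ∀ v, 0 ≤ e v := fun v => Nat.cast_nonneg _
    have hrec : ((m + 1 + 1)! : ℝ) * cliqueCount G (m + 1 + 1) U =
        ∑ v ∈ U, ((m + 1)! : ℝ) * cliqueCount G (m + 1) (N v) := by
      rw [← Finset.mul_sum, Nat.factorial_succ]
      have := congrArg (Nat.cast (R := ℝ)) (succ_mul_cliqueCount G (m + 1) U)
      push_cast at this ⊢
      rw [← this]
      ring
    have hterm : ∀ v ∈ U, ((m + 1)! : ℝ) * cliqueCount G (m + 1) (N v) ≤
        (1 + ε₁) ^ 2 * r ^ a * e v ^ α + ((1 + ε₁) * r ^ a * C₂ + C₁) := by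
      intro v hv
      have h4 := h₁ G (N v) (hfree.neighbors hv)
      have h5 := mul_le_mul_of_nonneg_left (h₂ (N v).card)
        (by positivity : 0 ≤ (1 + ε₁) * r ^ a)
      refine h4.trans ((add_le_add_left h5 C₁).trans (le_of_eq ?_))
      simp only [e]
      ring
    have hpow : ∑ v ∈ U, e v ^ (((s + 1 : ℕ) : ℝ)) ≤ r * u ^ (s + 1) := by
      have h6 := hfree.sum_pow_le
      have h7 : ((t - 1 : ℕ) : ℝ) = r := by rw [Nat.cast_sub ht, Nat.cast_one]
      have h8 := (Nat.cast_le (α := ℝ)).2 h6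
      push_cast [h7] at h8
      refine le_trans (le_of_eq (Finset.sum_congr rfl fun v _ => ?_)) h8
      rw [Real.rpow_natCast]
    have hpm : ∑ v ∈ U, e v ^ α ≤ r ^ (α / ((s + 1 : ℕ) : ℝ)) * u ^ β := by
      refine (sum_rpow_le_card_rpow_mul U e he0 hα0 hαs).trans ?_
      rcases eq_or_lt_of_le (Nat.cast_nonneg U.card : (0 : ℝ) ≤ U.card) with h0 | hupos
      · have hU : U = ∅ := Finset.card_eq_zero.1 (by exact_mod_cast h0.symm)
        rw [hU, Finset.sum_empty, Real.zero_rpow (by positivity), mul_zero]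
        positivity
      · have h9 := Real.rpow_le_rpow
          (Finset.sum_nonneg fun v _ => Real.rpow_nonneg (he0 v) _) hpow
          (by positivity : 0 ≤ α / ((s + 1 : ℕ) : ℝ))
        refine (mul_le_mul_of_nonneg_left h9 (by positivity)).trans (le_of_eq ?_)
        rw [Real.mul_rpow htpos.le (by positivity), ← Real.rpow_natCast, ← Real.rpow_mul hupos.le,
          mul_div_cancel₀ _ hS0.ne', mul_left_comm, ← Real.rpow_add hupos, hαβ]
    rw [hrec]
    calc ∑ v ∈ U, ((m + 1)! : ℝ) * cliqueCount G (m + 1) (N v)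
        ≤ ∑ v ∈ U, ((1 + ε₁) ^ 2 * r ^ a * e v ^ α + ((1 + ε₁) * r ^ a * C₂ + C₁)) :=
          Finset.sum_le_sum hterm
      _ = (1 + ε₁) ^ 2 * r ^ a * ∑ v ∈ U, e v ^ α + ((1 + ε₁) * r ^ a * C₂ + C₁) * u := by
          rw [Finset.sum_add_distrib, ← Finset.mul_sum, Finset.sum_const, nsmul_eq_mul,
            mul_comm (U.card : ℝ)]
      _ ≤ (1 + ε₁) ^ 2 * r ^ a * (r ^ (α / ((s + 1 : ℕ) : ℝ)) * u ^ β) +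
          (ε₁ * r ^ b * u ^ β + C₃) :=
          add_le_add (mul_le_mul_of_nonneg_left hpm (by positivity)) (h₃ _)
      _ = ((1 + ε₁) ^ 2 + ε₁) * (r ^ b * u ^ β) + C₃ := by
          rw [← hab, Real.rpow_add htpos]
          ring
      _ ≤ (1 + ε) * (r ^ b * u ^ β) + C₃ := by
          have : (1 + ε₁) ^ 2 + ε₁ ≤ 1 + ε := by nlinarith
          have h10 : 0 ≤ r ^ b * u ^ β := by positivity
          gcongr
      _ = _ := by ring

end UpperBound

/-! ### Primes in short intervals by a Wiener–Ikehara argument -/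

section WienerIkehara

open MeasureTheory Complex

/-- The triangle function of height one supported on `[-T, T]`. -/
noncomputable def triangle (T t : ℝ) : ℝ := max 0 (1 - |t| / T)

theorem continuous_triangle (T : ℝ) : Continuous (triangle T) := by
  unfold triangle; fun_prop

theorem triangle_nonneg (T t : ℝ) : 0 ≤ triangle T t := le_max_left _ _

theorem triangle_eq_zero {T : ℝ} (hT : 0 < T) {t : ℝ} (ht : T ≤ |t|) : triangle T t = 0 := by
  rw [triangle, max_eq_left]
  have : 1 ≤ |t| / T := (one_le_div hT).2 ht
  linarith

theorem hasCompactSupport_triangle {T : ℝ} (hT : 0 < T) : HasCompactSupport (triangle T) := by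
  refine HasCompactSupport.intro (isCompact_Icc (a := -T) (b := T)) fun t ht => ?_
  refine triangle_eq_zero hT ?_
  by_contra! h
  exact ht ⟨(abs_lt.1 h).1.le, (abs_lt.1 h).2.le⟩

theorem integrable_triangle {T : ℝ} (hT : 0 < T) : Integrable (triangle T) :=
  (continuous_triangle T).integrable_of_hasCompactSupport (hasCompactSupport_triangle hT)

/-- The Fejér kernel, up to normalisation. -/
noncomputable def fejer (T w : ℝ) : ℝ := T * Real.sinc (T * w / 2) ^ 2

theorem fejer_nonneg {T : ℝ} (hT : 0 ≤ T) (w : ℝ) : 0 ≤ fejer T w := by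
  unfold fejer; positivity

theorem continuous_fejer (T : ℝ) : Continuous (fejer T) := by
  unfold fejer
  have := Real.continuous_sinc
  fun_prop

theorem fejer_eq {T w : ℝ} (hT : 0 < T) (hw : w ≠ 0) :
    fejer T w = 4 * Real.sin (T * w / 2) ^ 2 / (T * w ^ 2) := by
  rw [fejer, Real.sinc_of_ne_zero (by positivity)]
  field_simp
  ring

theorem fejer_le {T w : ℝ} (hT : 0 < T) (hw : w ≠ 0) : fejer T w ≤ 4 / (T * w ^ 2) := by
  rw [fejer_eq hT hw]
  have := Real.sin_sq_le_one (T * w / 2)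
  gcongr
  linarith

theorem fejer_le_self {T : ℝ} (hT : 0 ≤ T) (w : ℝ) : fejer T w ≤ T := by
  have h1 := Real.sinc_le_one (T * w / 2)
  have h2 := Real.neg_one_le_sinc (T * w / 2)
  have h3 : Real.sinc (T * w / 2) ^ 2 ≤ 1 := by nlinarith
  unfold fejer
  nlinarith

theorem integral_triangle_mul_cos {T : ℝ} (hT : 0 < T) (w : ℝ) :
    ∫ t in (0 : ℝ)..T, (1 - t / T) * (2 * Real.cos (t * w)) = fejer T w := by
  rcases eq_or_ne w 0 with rfl | hw
  · have h : ∀ t ∈ Set.uIcc 0 T, HasDerivAt (fun t : ℝ => 2 * t - t ^ 2 / T)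
        ((1 - t / T) * (2 * Real.cos (t * 0))) t := by
      intro t _
      have := ((hasDerivAt_id t).const_mul 2).sub ((hasDerivAt_pow 2 t).div_const T)
      refine this.congr_deriv ?_
      simp
      ring
    rw [intervalIntegral.integral_eq_sub_of_hasDerivAt h
      ((by fun_prop : Continuous _).intervalIntegrable _ _)]
    simp [fejer]
    field_simp
    ring
  · have h : ∀ t ∈ Set.uIcc 0 T, HasDerivAt
        (fun t : ℝ => 2 * ((1 - t / T) * (Real.sin (t * w) / w) - Real.cos (t * w) / (T * w ^ 2)))
        ((1 - t / T) * (2 * Real.cos (t * w))) t := by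
      intro t _
      have h1 : HasDerivAt (fun t : ℝ => t * w) w t := by
        simpa using (hasDerivAt_id t).mul_const w
      have h2 := ((hasDerivAt_id t).div_const T).const_sub 1
      have := ((h2.mul (h1.sin.div_const w)).sub (h1.cos.div_const (T * w ^ 2))).const_mul 2
      refine this.congr_deriv ?_
      simp only [id]
      field_simp
      ring
    rw [intervalIntegral.integral_eq_sub_of_hasDerivAt h
      ((by fun_prop : Continuous _).intervalIntegrable _ _), fejer_eq hT hw]
    have h3 : Real.cos (T * w) = 1 - 2 * Real.sin (T * w / 2) ^ 2 := by
      have h4 := Real.cos_two_mul (T * w / 2)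
      rw [Real.cos_sq', mul_div_cancel₀ _ two_ne_zero] at h4
      linarith
    simp only [h3]
    field_simp
    simp
    ring

/-- A compactly supported function with nonnegative Fourier transform: only a bounded piece of a
vertical line enters, and the resulting weights are nonnegative. -/
theorem integral_triangle_mul_exp {T : ℝ} (hT : 0 < T) (w : ℝ) :
    ∫ t : ℝ, (triangle T t : ℂ) * cexp (-(I * t * w)) = (fejer T w : ℂ) := by
  let f : ℝ → ℂ := fun t => (triangle T t : ℂ) * cexp (-(I * t * w))
  have hf : Continuous f := by
    have := continuous_triangle T
    fun_prop
  have hsupp : Function.support f ⊆ Set.Ioc (-T) T := by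
    intro t ht
    by_contra h
    apply ht
    have : T ≤ |t| := by
      by_contra! h'
      exact h ⟨(abs_lt.1 h').1, (abs_lt.1 h').2.le⟩
    simp [f, triangle_eq_zero hT this]
  change ∫ t, f t = _
  rw [← intervalIntegral.integral_eq_integral_of_support_subset hsupp,
    ← intervalIntegral.integral_add_adjacent_intervals (b := 0) (hf.intervalIntegrable _ _)
      (hf.intervalIntegrable _ _)]
  have h1 : ∫ t in (-T)..0, f t = ∫ t in (0 : ℝ)..T, f (-t) := by
    rw [intervalIntegral.integral_comp_neg, neg_zero]
  have hf' : Continuous fun t => f (-t) := hf.comp continuous_neg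
  rw [h1, ← intervalIntegral.integral_add (hf'.intervalIntegrable _ _)
    (hf.intervalIntegrable _ _), ← integral_triangle_mul_cos hT w,
    ← intervalIntegral.integral_ofReal]
  refine intervalIntegral.integral_congr fun t ht => ?_
  rw [Set.uIcc_of_le hT.le] at ht
  have htri : triangle T t = 1 - t / T := by
    rw [triangle, abs_of_nonneg ht.1, max_eq_right]
    have : t / T ≤ 1 := (div_le_one hT).2 ht.2
    linarith
  have htri' : triangle T (-t) = 1 - t / T := by
    rw [← htri, triangle, triangle, abs_neg]
  simp only [f, htri, htri', ofReal_mul, ofReal_cos, ofReal_ofNat]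
  rw [Complex.two_cos]
  push_cast
  ring_nf

theorem fejer_scale (T w : ℝ) : fejer T w = T * fejer 1 (T * w) := by
  simp [fejer]

theorem integrable_fejer_one : Integrable (fejer 1) := by
  refine (integrable_inv_one_add_sq.const_mul 8).mono'
    (continuous_fejer 1).aestronglyMeasurable (ae_of_all _ fun w => ?_)
  rw [Real.norm_of_nonneg (fejer_nonneg zero_le_one w)]
  by_cases hw : w ^ 2 ≤ 1
  · refine (fejer_le_self zero_le_one w).trans ?_
    rw [← div_eq_mul_inv, le_div_iff₀ (by positivity)]
    linarith
  · push Not at hw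
    refine (fejer_le one_pos (by rintro rfl; norm_num at hw)).trans ?_
    rw [← div_eq_mul_inv, div_le_div_iff₀ (by positivity) (by positivity)]
    linarith

theorem integrable_fejer {T : ℝ} (hT : 0 < T) : Integrable (fejer T) := by
  have : fejer T = fun w => T * fejer 1 (T * w) := funext (fejer_scale T)
  rw [this]
  exact (integrable_fejer_one.comp_mul_left' hT.ne').const_mul T

theorem integral_fejer {T : ℝ} (hT : 0 < T) : ∫ w, fejer T w = ∫ w, fejer 1 w := by
  have : fejer T = fun w => T * fejer 1 (T * w) := funext (fejer_scale T)
  rw [this, integral_const_mul, Measure.integral_comp_mul_left, abs_of_pos (inv_pos.2 hT),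
    smul_eq_mul, mul_inv_cancel_left₀ hT.ne']

theorem integral_fejer_pos : 0 < ∫ w, fejer 1 w :=
  integral_pos_of_integrable_nonneg_nonzero (x := 0) (continuous_fejer 1) integrable_fejer_one (fejer_nonneg zero_le_one) (by simp [fejer])
theorem term_vertical_line (a : ℕ → ℝ) {σ : ℝ} (hσ : 1 < σ) (t : ℝ) (n : ℕ) :
    LSeries.term (fun n => (a n : ℂ)) (σ + I * t) n =
      ((a n / (n : ℝ) ^ σ : ℝ) : ℂ) * cexp (-(I * t * Real.log n)) := by
  rcases eq_or_ne n 0 with rfl | hn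
  · simp [Real.zero_rpow (by linarith : σ ≠ 0)]
  · have hn' : (n : ℂ) ≠ 0 := Nat.cast_ne_zero.2 hn
    rw [LSeries.term_of_ne_zero hn, cpow_add _ _ hn', ofReal_div, ofReal_cpow n.cast_nonneg,
      ofReal_natCast, cpow_def_of_ne_zero hn' (I * t), ← natCast_log, exp_neg]
    field_simp

theorem norm_exp_I_mul (t w : ℝ) : ‖cexp (I * t * w)‖ = 1 := by
  rw [show I * (t : ℂ) * w = ((t * w : ℝ) : ℂ) * I by push_cast; ring, norm_exp_ofReal_mul_I]

theorem norm_exp_neg_I_mul (t w : ℝ) : ‖cexp (-(I * t * w))‖ = 1 := by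
  rw [show -(I * (t : ℂ) * w) = I * t * (-w : ℝ) by push_cast; ring, norm_exp_I_mul]

theorem summable_div_rpow {a : ℕ → ℝ} (ha : ∀ n, 0 ≤ a n)
    (hs : ∀ s : ℂ, 1 < s.re → LSeriesSummable (fun n => (a n : ℂ)) s) {σ : ℝ} (hσ : 1 < σ) :
    Summable fun n : ℕ => a n / (n : ℝ) ^ σ := by
  have h := (hs (σ + I * (0 : ℝ)) (by simpa)).norm
  refine h.congr fun n => ?_
  rw [term_vertical_line a hσ, norm_mul, norm_exp_neg_I_mul, mul_one, norm_real,
    Real.norm_of_nonneg (div_nonneg (ha n) (by positivity))]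

/-- Integrating the Dirichlet series term by term against `triangle T` smooths its coefficients in
the variable `log n` around `y`. -/
theorem hasSum_fejer_of_lt {a : ℕ → ℝ} (ha : ∀ n, 0 ≤ a n)
    (hs : ∀ s : ℂ, 1 < s.re → LSeriesSummable (fun n => (a n : ℂ)) s)
    {T σ : ℝ} (hT : 0 < T) (hσ : 1 < σ) (y : ℝ) :
    HasSum (fun n : ℕ => ((a n / (n : ℝ) ^ σ * fejer T (Real.log n - y) : ℝ) : ℂ))
      (∫ t : ℝ, (triangle T t : ℂ) * (cexp (I * t * y) *
        LSeries (fun n => (a n : ℂ)) (σ + I * t))) := by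
  let F : ℕ → ℝ → ℂ := fun n t => (triangle T t : ℂ) * (cexp (I * t * y) *
        LSeries.term (fun n => (a n : ℂ)) (σ + I * t) n)
  have hF : ∀ n t, F n t = ((a n / (n : ℝ) ^ σ : ℝ) : ℂ) *
      ((triangle T t : ℂ) * cexp (-(I * t * (Real.log n - y : ℝ)))) := by
    intro n t
    simp only [F]
    have h : cexp (-(I * t * (Real.log n - y : ℝ))) =
        cexp (I * t * y) * cexp (-(I * t * Real.log n)) := by
      rw [← exp_add]
      congr 1
      push_cast
      ring
    rw [term_vertical_line a hσ, h]
    ring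
  have hFn : ∀ n t, ‖F n t‖ = a n / (n : ℝ) ^ σ * triangle T t := by
    intro n t
    rw [hF, norm_mul, norm_mul, norm_exp_neg_I_mul, mul_one, norm_real, norm_real,
      Real.norm_of_nonneg (div_nonneg (ha n) (by positivity)),
      Real.norm_of_nonneg (triangle_nonneg T t)]
  have hFi : ∀ n, Integrable (F n) := by
    intro n
    refine ((integrable_triangle hT).const_mul (a n / (n : ℝ) ^ σ)).mono' ?_
      (ae_of_all _ fun t => (hFn n t).le)
    have : F n = fun t => ((a n / (n : ℝ) ^ σ : ℝ) : ℂ) *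
      ((triangle T t : ℂ) * cexp (-(I * t * (Real.log n - y : ℝ)))) := funext (hF n)
    rw [this]
    have := continuous_triangle T
    exact (by fun_prop : Continuous _).aestronglyMeasurable
  have hsum : Summable fun n => ∫ t, ‖F n t‖ := by
    simp_rw [hFn, integral_const_mul]
    exact (summable_div_rpow ha hs hσ).mul_right _
  have h := hasSum_integral_of_summable_integral_norm hFi hsum
  have h1 : ∀ n, ∫ t, F n t = ((a n / (n : ℝ) ^ σ * fejer T (Real.log n - y) : ℝ) : ℂ) := by
    intro n
    simp_rw [hF]
    rw [integral_const_mul, integral_triangle_mul_exp hT, ofReal_mul]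
  simp_rw [h1] at h
  have h2 : ∫ t : ℝ, (triangle T t : ℂ) * (cexp (I * t * y) *
      LSeries (fun n => (a n : ℂ)) (σ + I * t)) = ∫ t, ∑' n, F n t := by
    refine integral_congr_ae (ae_of_all _ fun t => ?_)
    simp only [F]
    rw [tsum_mul_left, tsum_mul_left]
    rfl
  rwa [h2]

/-- Writing `1 / (s - 1)` as a Laplace integral turns the pole into a continuous analogue of the
smoothed sum. -/
theorem integral_triangle_mul_pole {T σ : ℝ} (hT : 0 < T) (hσ : 1 < σ) (y : ℝ) :
    ∫ t : ℝ, (triangle T t : ℂ) * (cexp (I * t * y) * (1 / (σ + I * t - 1))) =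
      ((∫ u in Set.Ioi (0 : ℝ), Real.exp (-(σ - 1) * u) * fejer T (u - y) : ℝ) : ℂ) := by
  have h1 : ∀ t : ℝ, (1 / ((σ : ℂ) + I * t - 1)) =
      ∫ u in Set.Ioi (0 : ℝ), cexp (-(σ + I * t - 1) * u) := by
    intro t
    rw [integral_exp_mul_complex_Ioi (by simpa using hσ), ofReal_zero, mul_zero, exp_zero,
      neg_div_neg_eq]
  let f : ℝ → ℝ → ℂ := fun t u => (triangle T t : ℂ) * (cexp (I * t * y) *
    cexp (-(σ + I * t - 1) * u))
  have hf : ∀ t u, f t u = (Real.exp (-(σ - 1) * u) : ℂ) *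
      ((triangle T t : ℂ) * cexp (-(I * t * (u - y : ℝ)))) := by
    intro t u
    simp only [f]
    rw [← exp_add, mul_left_comm, ofReal_exp, ← exp_add]
    congr 2
    push_cast
    ring
  have hint : Integrable (Function.uncurry f)
      ((volume : Measure ℝ).prod (volume.restrict (Set.Ioi (0 : ℝ)))) := by
    have h2 : Integrable (fun u : ℝ => Real.exp (-(σ - 1) * u))
        (volume.restrict (Set.Ioi (0 : ℝ))) :=
      integrableOn_exp_mul_Ioi (by linarith) 0
    refine ((integrable_triangle hT).mul_prod h2).mono' ?_ (ae_of_all _ fun p => ?_)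
    · have := continuous_triangle T
      exact (by simp only [f, Function.uncurry_def]; fun_prop : Continuous _).aestronglyMeasurable
    · change ‖f p.1 p.2‖ ≤ _
      rw [hf, norm_mul, norm_mul, norm_exp_neg_I_mul, norm_real, norm_real,
        Real.norm_of_nonneg (triangle_nonneg _ _), Real.norm_of_nonneg (Real.exp_pos _).le,
        mul_one, mul_comm]
  calc _ = ∫ t : ℝ, ∫ u in Set.Ioi (0 : ℝ), f t u := by
        refine integral_congr_ae (ae_of_all _ fun t => ?_)
        simp only [f]
        rw [integral_const_mul, integral_const_mul, h1]
    _ = ∫ u in Set.Ioi (0 : ℝ), ∫ t : ℝ, f t u := integral_integral_swap hint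
    _ = ∫ u in Set.Ioi (0 : ℝ), ((Real.exp (-(σ - 1) * u) * fejer T (u - y) : ℝ) : ℂ) := by
        refine integral_congr_ae (ae_of_all _ fun u => ?_)
        simp only [hf]
        rw [integral_const_mul, integral_triangle_mul_exp hT, ofReal_mul]
    _ = _ := integral_ofReal

theorem continuous_vertical_line {G : ℂ → ℂ} (hG : ContinuousOn G {s | 1 ≤ s.re}) {σ : ℝ}
    (hσ : 1 ≤ σ) : Continuous fun t : ℝ => G (σ + I * t) := by
  refine hG.comp_continuous (by fun_prop) fun t => ?_
  simpa using hσ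

theorem integrable_triangle_mul {T : ℝ} (hT : 0 < T) {f : ℝ → ℂ} (hf : Continuous f) :
    Integrable fun t : ℝ => (triangle T t : ℂ) * f t := by
  have h1 := continuous_triangle T
  refine Continuous.integrable_of_hasCompactSupport (by fun_prop) ?_
  refine HasCompactSupport.mul_right ?_
  exact (hasCompactSupport_triangle hT).comp_left (g := fun x : ℝ => (x : ℂ)) ofReal_zero

theorem tendsto_integral_triangle_mul {G : ℂ → ℂ} (hG : ContinuousOn G {s | 1 ≤ s.re}) {T : ℝ}
    (hT : 0 < T) (y : ℝ) :
    Tendsto (fun σ : ℝ => ∫ t : ℝ, (triangle T t : ℂ) * (cexp (I * t * y) * G (σ + I * t)))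
      (𝓝[>] 1) (𝓝 (∫ t : ℝ, (triangle T t : ℂ) * (cexp (I * t * y) * G ((1 : ℝ) + I * t)))) := by
  have hcomp : IsCompact ((Set.Icc (1 : ℝ) 2) ×ˢ (Set.Icc (-T) T)) :=
    isCompact_Icc.prod isCompact_Icc
  have hcont : ContinuousOn (fun p : ℝ × ℝ => G (p.1 + I * p.2))
      ((Set.Icc (1 : ℝ) 2) ×ˢ (Set.Icc (-T) T)) := by
    refine hG.comp (by fun_prop) fun p hp => ?_
    simpa using hp.1.1
  obtain ⟨C, hC⟩ := hcomp.exists_bound_of_continuousOn hcont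
  have hev : ∀ᶠ σ : ℝ in 𝓝[>] 1, 1 < σ ∧ σ ≤ 2 := by
    have := Ioc_mem_nhdsGT (show (1 : ℝ) < 2 by norm_num)
    exact this
  refine tendsto_integral_filter_of_dominated_convergence (fun t => triangle T t * C) ?_ ?_
    ((integrable_triangle hT).mul_const C) ?_
  · filter_upwards [hev] with σ hσ
    have h1 := continuous_vertical_line hG hσ.1.le
    have h2 := continuous_triangle T
    have h3 : Continuous fun t : ℝ => cexp (I * t * y) := by fun_prop
    exact ((continuous_ofReal.comp h2).mul (h3.mul h1)).aestronglyMeasurable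
  · filter_upwards [hev] with σ hσ
    refine ae_of_all _ fun t => ?_
    rw [norm_mul, norm_mul, norm_exp_I_mul, one_mul, norm_real,
      Real.norm_of_nonneg (triangle_nonneg _ _)]
    rcases le_or_gt T |t| with h | h
    · simp [triangle_eq_zero hT h]
    · exact mul_le_mul_of_nonneg_left
        (hC (σ, t) ⟨⟨hσ.1.le, hσ.2⟩, (abs_lt.1 h).1.le, (abs_lt.1 h).2.le⟩) (triangle_nonneg _ _)
  · refine ae_of_all _ fun t => ?_
    refine Tendsto.const_mul _ (Tendsto.const_mul _ ?_)
    have h1 : ContinuousWithinAt G {s | 1 ≤ s.re} ((1 : ℝ) + I * t) := hG _ (by simp)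
    refine h1.tendsto.comp (tendsto_nhdsWithin_iff.2 ⟨?_, ?_⟩)
    · have : Continuous fun σ : ℝ => (σ : ℂ) + I * t := by fun_prop
      exact (this.tendsto 1).mono_left nhdsWithin_le_nhds
    · filter_upwards [hev] with σ hσ
      simpa using hσ.1.le

theorem tendsto_integral_exp_mul_fejer {T : ℝ} (hT : 0 < T) (y : ℝ) :
    Tendsto (fun σ : ℝ => ∫ u in Set.Ioi (0 : ℝ), Real.exp (-(σ - 1) * u) * fejer T (u - y))
      (𝓝[>] 1) (𝓝 (∫ u in Set.Ioi (0 : ℝ), fejer T (u - y))) := by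
  have hcf := continuous_fejer T
  refine tendsto_integral_filter_of_dominated_convergence (fun u => fejer T (u - y)) ?_ ?_
    ((integrable_fejer hT).comp_sub_right y).integrableOn ?_
  · exact Eventually.of_forall fun σ => (by fun_prop : Continuous _).aestronglyMeasurable
  · filter_upwards [self_mem_nhdsWithin] with σ hσ
    refine (ae_restrict_iff' measurableSet_Ioi).2 (ae_of_all _ fun u hu => ?_)
    rw [Real.norm_of_nonneg (mul_nonneg (Real.exp_pos _).le (fejer_nonneg hT.le _))]
    refine mul_le_of_le_one_left (fejer_nonneg hT.le _) (Real.exp_le_one_iff.2 ?_)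
    have h1 : (0 : ℝ) < u := hu
    have h2 : (1 : ℝ) < σ := hσ
    nlinarith
  · refine ae_of_all _ fun u => ?_
    have h : Continuous fun σ : ℝ => Real.exp (-(σ - 1) * u) * fejer T (u - y) := by fun_prop
    have := (h.tendsto 1).mono_left (nhdsWithin_le_nhds (s := Set.Ioi 1))
    simpa using this

/-- The limit `σ → 1+`. Nonnegativity bounds the partial sums by the limit, giving summability on
the line; the reverse inequality follows from `n ^ (-σ) ≤ n ^ (-1)`. -/
theorem hasSum_fejer {a : ℕ → ℝ} (ha : ∀ n, 0 ≤ a n)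
    (hs : ∀ s : ℂ, 1 < s.re → LSeriesSummable (fun n => (a n : ℂ)) s) {G : ℂ → ℂ}
    (hG : ContinuousOn G {s | 1 ≤ s.re})
    (heq : ∀ s : ℂ, 1 < s.re → LSeries (fun n => (a n : ℂ)) s = G s + 1 / (s - 1))
    {T : ℝ} (hT : 0 < T) (y : ℝ) :
    HasSum (fun n : ℕ => a n / n * fejer T (Real.log n - y))
      ((∫ t : ℝ, (triangle T t : ℂ) * (cexp (I * t * y) * G ((1 : ℝ) + I * t))).re +
        ∫ u in Set.Ioi (0 : ℝ), fejer T (u - y)) := by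
  let R : ℝ → ℝ := fun σ =>
    (∫ t : ℝ, (triangle T t : ℂ) * (cexp (I * t * y) * G (σ + I * t))).re +
      ∫ u in Set.Ioi (0 : ℝ), Real.exp (-(σ - 1) * u) * fejer T (u - y)
  have hR : ∀ σ : ℝ, 1 < σ →
      HasSum (fun n : ℕ => a n / (n : ℝ) ^ σ * fejer T (Real.log n - y)) (R σ) := by
    intro σ hσ
    have h := hasSum_fejer_of_lt ha hs hT hσ y
    have hsplit : ∫ t : ℝ, (triangle T t : ℂ) * (cexp (I * t * y) *
        LSeries (fun n => (a n : ℂ)) (σ + I * t)) =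
        (∫ t : ℝ, (triangle T t : ℂ) * (cexp (I * t * y) * G (σ + I * t))) +
        ((∫ u in Set.Ioi (0 : ℝ), Real.exp (-(σ - 1) * u) * fejer T (u - y) : ℝ) : ℂ) := by
      have h1 := continuous_vertical_line hG hσ.le
      have h2 : Continuous fun t : ℝ => 1 / ((σ : ℂ) + I * t - 1) := by
        refine continuous_const.div (by fun_prop) fun t h0 => ?_
        have := congrArg re h0
        simp at this
        linarith
      have h3 : Continuous fun t : ℝ => cexp (I * t * y) := by fun_prop
      rw [← integral_triangle_mul_pole hT hσ, ← integral_add]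
      rotate_left
      · exact integrable_triangle_mul hT (h3.mul h1)
      · exact integrable_triangle_mul hT (h3.mul h2)
      refine integral_congr_ae (ae_of_all _ fun t => ?_)
      simp only
      rw [heq _ (by simpa using hσ)]
      ring
    rw [hsplit] at h
    have h3 := hasSum_re h
    simpa [R] using h3
  have hlim : Tendsto R (𝓝[>] 1) (𝓝 ((∫ t : ℝ, (triangle T t : ℂ) *
      (cexp (I * t * y) * G ((1 : ℝ) + I * t))).re + ∫ u in Set.Ioi (0 : ℝ), fejer T (u - y))) :=
    ((continuous_re.tendsto _).comp (tendsto_integral_triangle_mul hG hT y)).add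
      (tendsto_integral_exp_mul_fejer hT y)
  have hterm : ∀ n : ℕ, Tendsto (fun σ : ℝ => a n / (n : ℝ) ^ σ * fejer T (Real.log n - y))
      (𝓝[>] 1) (𝓝 (a n / n * fejer T (Real.log n - y))) := by
    intro n
    rcases eq_or_ne n 0 with rfl | hn
    · refine tendsto_const_nhds.congr' ?_
      filter_upwards [self_mem_nhdsWithin] with σ hσ
      have : (1 : ℝ) < σ := hσ
      simp [Real.zero_rpow (by linarith : σ ≠ 0)]
    · have hn' : (n : ℝ) ≠ 0 := Nat.cast_ne_zero.2 hn
      have h1 : ContinuousAt (fun σ : ℝ => a n / (n : ℝ) ^ σ * fejer T (Real.log n - y)) 1 :=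
        (continuousAt_const.div (Real.continuousAt_const_rpow hn') (by simpa)).mul
          continuousAt_const
      have := h1.tendsto.mono_left (nhdsWithin_le_nhds (s := Set.Ioi 1))
      simpa using this
  have hnn : ∀ n : ℕ, 0 ≤ a n / n * fejer T (Real.log n - y) := fun n =>
    mul_nonneg (div_nonneg (ha n) n.cast_nonneg) (fejer_nonneg hT.le _)
  have hle : ∀ s : Finset ℕ, ∑ n ∈ s, a n / n * fejer T (Real.log n - y) ≤ _ := fun s =>
    le_of_tendsto_of_tendsto (tendsto_finsetSum s fun n _ => hterm n) hlim (by
      filter_upwards [self_mem_nhdsWithin] with σ hσ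
      exact sum_le_hasSum s (fun n _ => mul_nonneg (div_nonneg (ha n) (by positivity))
        (fejer_nonneg hT.le _)) (hR σ hσ))
  have hsum : Summable fun n : ℕ => a n / n * fejer T (Real.log n - y) :=
    summable_of_sum_le hnn hle
  convert hsum.hasSum using 1
  refine le_antisymm ?_ (hsum.tsum_le_of_sum_le hle)
  refine le_of_tendsto hlim ?_
  filter_upwards [self_mem_nhdsWithin] with σ hσ
  refine hasSum_le (fun n => ?_) (hR σ hσ) hsum.hasSum
  rcases eq_or_ne n 0 with rfl | hn
  · have : (1 : ℝ) < σ := hσ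
    simp [Real.zero_rpow (by linarith : σ ≠ 0)]
  · have h1 : (1 : ℝ) ≤ n := Nat.one_le_cast.2 (Nat.one_le_iff_ne_zero.2 hn)
    refine mul_le_mul_of_nonneg_right ?_ (fejer_nonneg hT.le _)
    refine div_le_div_of_nonneg_left (ha n) (by linarith) ?_
    exact Real.self_le_rpow_of_one_le h1 (le_of_lt hσ)

/-- As `y → ∞`, the Riemann–Lebesgue lemma removes the continuous part `G`, and the pole contributes
the full mass of the kernel. -/
theorem tendsto_tsum_fejer {a : ℕ → ℝ} (ha : ∀ n, 0 ≤ a n)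
    (hs : ∀ s : ℂ, 1 < s.re → LSeriesSummable (fun n => (a n : ℂ)) s) {G : ℂ → ℂ}
    (hG : ContinuousOn G {s | 1 ≤ s.re})
    (heq : ∀ s : ℂ, 1 < s.re → LSeries (fun n => (a n : ℂ)) s = G s + 1 / (s - 1))
    {T : ℝ} (hT : 0 < T) :
    Tendsto (fun y : ℝ => ∑' n : ℕ, a n / n * fejer T (Real.log n - y)) atTop
      (𝓝 (∫ w, fejer 1 w)) := by
  simp_rw [fun y => (hasSum_fejer ha hs hG heq hT y).tsum_eq]
  rw [← zero_add (∫ w, fejer 1 w), ← integral_fejer hT]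
  refine Tendsto.add ?_ ?_
  · have h1 := Real.tendsto_integral_exp_smul_cocompact
      (fun t : ℝ => (triangle T t : ℂ) * G ((1 : ℝ) + I * t))
    have h2 : Tendsto (fun y : ℝ => -y / (2 * Real.pi)) atTop (cocompact ℝ) := by
      have h3 : Tendsto (fun y : ℝ => -y / (2 * Real.pi)) atTop atBot :=
        (tendsto_neg_atTop_atBot).atBot_div_const (by positivity)
      exact h3.mono_right atBot_le_cocompact
    have h4 := (continuous_re.tendsto 0).comp (h1.comp h2)
    rw [zero_re] at h4
    refine h4.congr fun y => ?_
    simp only [Function.comp]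
    congr 2
    ext t
    rw [Circle.smul_def, Real.fourierChar_apply, smul_eq_mul]
    have : cexp (((2 * Real.pi * (-(t * (-y / (2 * Real.pi)))) : ℝ) : ℂ) * I) =
        cexp (I * t * y) := by
      congr 1
      have : 2 * Real.pi * (-(t * (-y / (2 * Real.pi)))) = t * y := by
        field_simp
      rw [this]
      push_cast
      ring
    rw [this]
    ring
  · have h1 : ∀ y : ℝ, ∫ u in Set.Ioi (0 : ℝ), fejer T (u - y) =
        ∫ w in Set.Ioi (-y), fejer T w := by
      intro y
      rw [← integral_indicator measurableSet_Ioi, ← integral_indicator measurableSet_Ioi,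
        ← integral_sub_right_eq_self ((Set.Ioi (-y)).indicator _) y]
      congr 1
      ext u
      simp only [Set.indicator, Set.mem_Ioi, neg_lt_sub_iff_lt_add, lt_add_iff_pos_right]
    simp_rw [h1]
    exact (aecover_Ioi tendsto_neg_atTop_atBot).integral_tendsto_of_countably_generated
      (integrable_fejer hT)

/-- Away from the origin the kernel decays like `1 / (T * w ^ 2)`. A single kernel has zeros and
cannot dominate this, but two kernels shifted by `π / 2` can, since `sin ^ 2 + cos ^ 2 = 1`. -/
theorem fejer_le_mul_add {η w T : ℝ} (hη : 0 < η) (hw : η ≤ |w|) (hT : 0 < T) :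
    fejer T w ≤ 2 * (1 + (1 + 2 / η) ^ 2) / T * (fejer 2 w + fejer 2 (w + Real.pi / 2)) := by
  have hw0 : w ≠ 0 := by
    rintro rfl
    simp at hw
    linarith
  have hw2 : 0 < w ^ 2 := by positivity
  set D := w ^ 2 + (w + Real.pi / 2) ^ 2 with hD
  have hDpos : 0 < D := by positivity
  have hlow : 2 / D ≤ fejer 2 w + fejer 2 (w + Real.pi / 2) := by
    have h1 : 2 * Real.sin w ^ 2 / D ≤ fejer 2 w := by
      rw [fejer_eq two_pos hw0, mul_div_cancel_left₀ _ two_ne_zero,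
        show 4 * Real.sin w ^ 2 / (2 * w ^ 2) = 2 * Real.sin w ^ 2 / w ^ 2 by field_simp; ring]
      gcongr
      nlinarith [sq_nonneg (w + Real.pi / 2)]
    have h2 : 2 * Real.cos w ^ 2 / D ≤ fejer 2 (w + Real.pi / 2) := by
      rcases eq_or_ne (w + Real.pi / 2) 0 with h0 | h0
      · have : w = -(Real.pi / 2) := by linarith
        rw [this, Real.cos_neg, Real.cos_pi_div_two]
        simpa using fejer_nonneg zero_le_two _
      · have hpos : 0 < (w + Real.pi / 2) ^ 2 := by positivity
        rw [fejer_eq two_pos h0, mul_div_cancel_left₀ _ two_ne_zero, Real.sin_add_pi_div_two,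
          show 4 * Real.cos w ^ 2 / (2 * (w + Real.pi / 2) ^ 2) =
            2 * Real.cos w ^ 2 / (w + Real.pi / 2) ^ 2 by field_simp; ring]
        gcongr
        nlinarith
    calc 2 / D = 2 * Real.sin w ^ 2 / D + 2 * Real.cos w ^ 2 / D := by
          rw [← add_div, ← mul_add, Real.sin_sq_add_cos_sq, mul_one]
      _ ≤ _ := add_le_add h1 h2
  have hDle : D ≤ (1 + (1 + 2 / η) ^ 2) * w ^ 2 := by
    have h1 : |w + Real.pi / 2| ≤ (1 + 2 / η) * |w| := by
      have h2 : Real.pi / 2 ≤ 2 / η * |w| := by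
        have h3 : 2 ≤ 2 / η * |w| := by
          rw [div_mul_eq_mul_div, le_div_iff₀ hη]
          linarith
        linarith [Real.pi_le_four]
      calc |w + Real.pi / 2| ≤ |w| + |Real.pi / 2| := abs_add_le _ _
        _ = |w| + Real.pi / 2 := by rw [abs_of_pos (by positivity : 0 < Real.pi / 2)]
        _ ≤ _ := by linarith
    have h4 : (w + Real.pi / 2) ^ 2 ≤ (1 + 2 / η) ^ 2 * w ^ 2 := by
      rw [← sq_abs, ← sq_abs w, ← mul_pow]
      gcongr
    rw [hD]
    linarith
  calc fejer T w ≤ 4 / (T * w ^ 2) := fejer_le hT hw0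
    _ ≤ 2 * (1 + (1 + 2 / η) ^ 2) / T * (2 / D) := by
        rw [div_mul_div_comm, div_le_div_iff₀ (by positivity) (by positivity)]
        nlinarith
    _ ≤ _ := by gcongr

/-- If no index with a nonzero coefficient were near `y`, the comparison with `T = 6 * M` would
bound the smoothed sum by a sixth of two sums tending to `c`, hence eventually below `c / 2`, while
it must itself tend to `c`. -/
theorem eventually_exists_ne_zero_log_near {a : ℕ → ℝ} (ha : ∀ n, 0 ≤ a n)
    (hs : ∀ s : ℂ, 1 < s.re → LSeriesSummable (fun n => (a n : ℂ)) s) {G : ℂ → ℂ}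
    (hG : ContinuousOn G {s | 1 ≤ s.re})
    (heq : ∀ s : ℂ, 1 < s.re → LSeries (fun n => (a n : ℂ)) s = G s + 1 / (s - 1))
    {η : ℝ} (hη : 0 < η) :
    ∀ᶠ y : ℝ in atTop, ∃ n : ℕ, a n ≠ 0 ∧ |Real.log n - y| < η := by
  have hc := integral_fejer_pos
  set c := ∫ w, fejer 1 w with hcdef
  set M := 2 * (1 + (1 + 2 / η) ^ 2) with hM
  have hMpos : 0 < M := by positivity
  have hT : 0 < 6 * M := by positivity
  have h2 := tendsto_tsum_fejer ha hs hG heq two_pos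
  have h2' : Tendsto (fun y : ℝ => ∑' n : ℕ, a n / n * fejer 2 (Real.log n - (y - Real.pi / 2)))
      atTop (𝓝 c) := h2.comp (tendsto_atTop_add_const_right _ _ tendsto_id)
  have hT' := tendsto_tsum_fejer ha hs hG heq hT
  have hlim := h2.add h2'
  filter_upwards [hlim.eventually_lt_const (show c + c < 3 * c by linarith),
    hT'.eventually_const_lt (show c / 2 < c by linarith)] with y hy1 hy2
  by_contra! hno
  have hsum1 := (hasSum_fejer ha hs hG heq two_pos y).summable
  have hsum2 := (hasSum_fejer ha hs hG heq two_pos (y - Real.pi / 2)).summable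
  have hsumT := (hasSum_fejer ha hs hG heq hT y).summable
  have hle : ∑' n : ℕ, a n / n * fejer (6 * M) (Real.log n - y) ≤
      ∑' n : ℕ, M / (6 * M) * (a n / n * fejer 2 (Real.log n - y) +
        a n / n * fejer 2 (Real.log n - (y - Real.pi / 2))) := by
    refine hsumT.tsum_le_tsum (fun n => ?_) ((hsum1.add hsum2).mul_left _)
    by_cases han : a n = 0
    · simp [han]
    · have h3 := fejer_le_mul_add hη (hno n han) hT
      have h4 : 0 ≤ a n / n := div_nonneg (ha n) n.cast_nonneg
      have h5 := mul_le_mul_of_nonneg_left h3 h4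
      rw [show Real.log n - (y - Real.pi / 2) = Real.log n - y + Real.pi / 2 by ring]
      linarith
  rw [tsum_mul_left, hsum1.tsum_add hsum2] at hle
  have h6 : M / (6 * M) = 1 / 6 := by field_simp
  rw [h6] at hle
  linarith

/-- The von Mangoldt series modulo `1` has only the pole at `1` on the line `Re s = 1`. Higher prime
powers contribute a series converging absolutely there, so discarding them keeps the remainder
continuous. -/
theorem eventually_exists_prime_log_near {η : ℝ} (hη : 0 < η) :
    ∀ᶠ y : ℝ in atTop, ∃ p : ℕ, p.Prime ∧ |Real.log p - y| < η := by
  let Λ : ℕ → ℝ := ArithmeticFunction.vonMangoldt.residueClass (1 : ZMod 1)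
  have hΛ0 : ∀ n, 0 ≤ Λ n := ArithmeticFunction.vonMangoldt.residueClass_nonneg _
  let a : ℕ → ℝ := fun n => if n.Prime then Λ n else 0
  let b : ℕ → ℝ := fun n => if n.Prime then 0 else Λ n
  have hab : ∀ n, (Λ n : ℂ) = a n + b n := fun n => by
    by_cases h : n.Prime <;> simp [a, b, h]
  have hΛs : ∀ s : ℂ, 1 < s.re → LSeriesSummable (fun n => (Λ n : ℂ)) s := fun s hs =>
    LSeriesSummable_of_abscissaOfAbsConv_lt_re
      (lt_of_le_of_lt (ArithmeticFunction.vonMangoldt.abscissaOfAbsConv_residueClass_le_one _)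
        (by exact_mod_cast hs))
  have has : ∀ s : ℂ, 1 < s.re → LSeriesSummable (fun n => (a n : ℂ)) s := fun s hs => by
    refine (hΛs s hs).norm.of_norm_bounded fun n => LSeries.norm_term_le s ?_
    by_cases h : n.Prime <;> simp [a, h]
  have hbs : ∀ s : ℂ, 1 < s.re → LSeriesSummable (fun n => (b n : ℂ)) s := fun s hs => by
    refine (hΛs s hs).norm.of_norm_bounded fun n => LSeries.norm_term_le s ?_
    by_cases h : n.Prime <;> simp [b, h]
  have hbcont : ContinuousOn (LSeries fun n => (b n : ℂ)) {s | 1 ≤ s.re} := by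
    have hsum : Summable fun n : ℕ => b n / n :=
      ArithmeticFunction.vonMangoldt.summable_residueClass_non_primes_div (1 : ZMod 1)
    refine continuousOn_tsum (fun n => ?_) hsum fun n s hs => ?_
    · rcases eq_or_ne n 0 with rfl | hn
      · simpa using continuousOn_const
      · have hn' : (n : ℂ) ≠ 0 := Nat.cast_ne_zero.2 hn
        refine Continuous.continuousOn ?_
        simp_rw [LSeries.term_of_ne_zero hn]
        refine continuous_const.div (continuous_id.const_cpow (Or.inl hn')) fun s => ?_
        simp [cpow_eq_zero_iff, hn']
    · have hb0 : 0 ≤ b n := by by_cases h : n.Prime <;> simp [b, h, hΛ0]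
      have := LSeries.norm_term_le_of_re_le_re (fun n => (b n : ℂ)) (s := 1) (s' := s) hs n
      refine this.trans ?_
      rw [LSeries.norm_term_eq]
      split_ifs with h
      · simp [h]
      · simp [abs_of_nonneg hb0]
  let G : ℂ → ℂ := fun s =>
    ArithmeticFunction.vonMangoldt.LFunctionResidueClassAux (1 : ZMod 1) s -
      LSeries (fun n => (b n : ℂ)) s
  have hG : ContinuousOn G {s | 1 ≤ s.re} :=
    (ArithmeticFunction.vonMangoldt.continuousOn_LFunctionResidueClassAux _).sub hbcont
  have heq : ∀ s : ℂ, 1 < s.re → LSeries (fun n => (a n : ℂ)) s = G s + 1 / (s - 1) := by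
    intro s hs
    have h1 := ArithmeticFunction.vonMangoldt.eqOn_LFunctionResidueClassAux
      (isUnit_one : IsUnit (1 : ZMod 1)) hs
    have h2 : LSeries (fun n => (Λ n : ℂ)) s =
        LSeries (fun n => (a n : ℂ)) s + LSeries (fun n => (b n : ℂ)) s := by
      rw [← LSeries_add (has s hs) (hbs s hs)]
      exact LSeries_congr (fun {n} _ => hab n) s
    simp only [G]
    rw [h1]
    simp only [Nat.totient_one, Nat.cast_one, inv_one]
    have h3 : LSeries (fun n => (ArithmeticFunction.vonMangoldt.residueClass (1 : ZMod 1) n : ℂ)) s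
      = LSeries (fun n => (Λ n : ℂ)) s := rfl
    rw [h3, h2]
    ring
  have ha0 : ∀ n, 0 ≤ a n := fun n => by by_cases h : n.Prime <;> simp [a, h, hΛ0]
  filter_upwards [eventually_exists_ne_zero_log_near ha0 has hG heq hη] with y hy
  obtain ⟨n, hn, hny⟩ := hy
  refine ⟨n, ?_, hny⟩
  by_contra h
  exact hn (by simp [a, h])

/-- Consecutive primes are asymptotically equal: every interval `((1 - ε) x, x]` contains a prime
once `x` is large. -/
theorem eventually_exists_prime_mem_Ioc {ε : ℝ} (hε : 0 < ε) :
    ∀ᶠ x : ℝ in atTop, ∃ p : ℕ, p.Prime ∧ (1 - ε) * x < p ∧ (p : ℝ) ≤ x := by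
  -- The prime is sought near `log x - η`, so that its logarithm lies in `(log x - 2η, log x)`;
  -- moreover `1 / (1 + ε) ≥ 1 - ε`.
  let η := Real.log (1 + ε) / 2
  have hη : 0 < η := by
    have := Real.log_pos (show 1 < 1 + ε by linarith)
    positivity
  have h := (tendsto_atTop_add_const_right _ (-η) Real.tendsto_log_atTop).eventually
    (eventually_exists_prime_log_near hη)
  filter_upwards [h, eventually_gt_atTop 0] with x hx hx0
  obtain ⟨p, hp, hpx⟩ := hx
  have hp0 : (0 : ℝ) < p := Nat.cast_pos.2 hp.pos
  obtain ⟨h1, h2⟩ := abs_lt.1 hpx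
  refine ⟨p, hp, ?_, ?_⟩
  · have h3 : Real.log x - Real.log (1 + ε) < Real.log p := by
      simp only [η] at h1 h2
      linarith
    rw [← Real.log_div hx0.ne' (by positivity)] at h3
    have h4 := (Real.log_lt_log_iff (by positivity) hp0).1 h3
    refine lt_of_le_of_lt ?_ h4
    rw [le_div_iff₀ (by positivity)]
    nlinarith [mul_pos hε hε]
  · exact ((Real.log_lt_log_iff hp0 hx0).1 (by linarith)).le

end WienerIkehara

/-! ### Cliques in the projective norm graph -/

section NormGraphCliques

/-- The projective norm graph. -/
def normGraph (F K : Type*) [Field F] [Field K] [Algebra F K] : SimpleGraph (K × Fˣ) where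
  Adj v w := v ≠ w ∧ normAdj v w
  symm := ⟨fun _ _ h => ⟨h.1.symm, normAdj_comm.1 h.2⟩⟩
  loopless := ⟨fun _ h => h.1 rfl⟩

variable {F K : Type*} [Field F] [Field K] [Algebra F K] [Fintype F] [Fintype K]

theorem free_normGraph {s t : ℕ} (hs : s = Module.finrank F K + 1)
    (ht : (Module.finrank F K)! < t) :
    (completeBipartiteGraph (Fin s) (Fin t)).Free (normGraph F K) := by
  classical
  refine free_completeBipartiteGraph _ fun S hS => lt_of_le_of_lt ?_ ht
  refine le_trans (Finset.card_le_card fun w hw => ?_)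
    (card_commonNeighbors_normAdj_le S (hS.trans hs))
  simp only [Finset.mem_filter, Finset.mem_univ, true_and] at hw ⊢
  exact fun v hv => (hw v hv).2

-- For each first coordinate, a looped vertex has its second coordinate determined up to sign.
open Classical in
theorem card_filter_normAdj_self_le :
    (Finset.univ.filter fun v : K × Fˣ => normAdj v v).card ≤ 2 * Fintype.card K := by
  rw [Finset.card_eq_sum_card_fiberwise (f := Prod.fst) (t := Finset.univ)
    (fun _ _ => Finset.mem_coe.2 (Finset.mem_univ _)), mul_comm, ← smul_eq_mul,
    ← Finset.card_univ, ← Finset.sum_const]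
  refine Finset.sum_le_sum fun k _ => ?_
  rcases (Finset.filter (fun v : K × Fˣ => v.1 = k)
    (Finset.univ.filter fun v => normAdj v v)).eq_empty_or_nonempty with h0 | ⟨v, hv⟩
  · rw [h0]; simp
  · refine le_trans (Finset.card_le_card (t := {v, (v.1, -v.2)}) fun w hw => ?_)
      Finset.card_le_two
    simp only [Finset.mem_filter, Finset.mem_univ, true_and] at hv hw
    have h1 := hv.1
    have h2 := hw.1
    have h3 : w.1 = v.1 := hw.2.trans hv.2.symm
    rw [normAdj] at h1 h2
    rw [h3, h1] at h2
    rw [Finset.mem_insert, Finset.mem_singleton]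
    rcases mul_self_eq_mul_self_iff.1 h2 with h4 | h4
    · exact Or.inl (Prod.ext h3 (Units.ext h4.symm))
    · refine Or.inr (Prod.ext h3 (Units.ext ?_))
      rw [Units.val_neg, h4, neg_neg]

/-- The projective norm graph over a large field has many cliques. -/
theorem le_cliqueCount_normGraph {s m q : ℕ} (hs : s = Module.finrank F K + 1) (hm : 2 ≤ m)
    (hms : 2 * m - 2 ≤ s) (hq : Fintype.card F = q) {δ : ℝ} (hδ : 0 < δ) (hδ1 : δ < 1)
    (hq1 : 3 ≤ δ * q) (hq2 : 1 ≤ δ ^ 3 * (1 - δ) ^ (2 * m) * q) :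
    ∃ U : Finset (K × Fˣ), (1 - δ) ^ (m ^ 2 + m) * (q : ℝ) ^ (s * m - m.choose 2) ≤
      (m ! : ℝ) * cliqueCount (normGraph F K) m U := by
  classical
  set d := Module.finrank F K with hd
  have hKq : Fintype.card K = q ^ d := by rw [Module.card_eq_pow_finrank (K := F), hq]
  have hq0 : 0 < q := hq ▸ Fintype.card_pos
  have hq0' : (0 : ℝ) < q := Nat.cast_pos.2 hq0
  have hqone : (1 : ℝ) ≤ q := Nat.one_le_cast.2 hq0
  set R : ℝ := ((Finset.univ.filter fun z : K => Algebra.norm F z = 1).card : ℝ) with hR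
  set Q : ℝ := (Fintype.card K : ℝ) with hQ
  have hQq : Q = (q : ℝ) ^ d := by rw [hQ, hKq]; push_cast; rfl
  have hQ0 : 0 < Q := by rw [hQq]; positivity
  have hR1 : 1 ≤ R := by
    rw [hR]
    refine Nat.one_le_cast.2 (Finset.card_pos.2 ⟨1, ?_⟩)
    simp
  have hRQ : R ≤ Q := Nat.cast_le.2 (Finset.card_le_univ _)
  have hRq : R * ((q : ℝ) - 1) = Q - 1 := by
    have h1 := congrArg (Nat.cast (R := ℝ)) (card_norm_eq_one_mul F K)
    rwa [Nat.cast_mul, Nat.cast_sub Fintype.card_pos, Nat.cast_sub Fintype.card_pos,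
      Nat.cast_one, hq] at h1
  set p : ℝ := R / Q with hp
  have hp0 : 0 < p := by positivity
  have hp1 : p ≤ 1 := (div_le_one hQ0).2 hRQ
  have hpq : (q : ℝ)⁻¹ ≤ p := by
    rw [hp, inv_eq_one_div, div_le_div_iff₀ hq0' hQ0]
    linarith
  -- On loopless vertices, graph adjacency agrees with `normAdj`, so the variance bound transfers
  -- unchanged.
  let U₀ : Finset (K × Fˣ) := Finset.univ.filter fun v => ¬ normAdj v v
  have hadj : ∀ v ∈ U₀, ∀ w, (normGraph F K).Adj v w ↔ normAdj w v := by
    intro v hv w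
    refine ⟨fun h => normAdj_comm.1 h.2, fun h => ⟨?_, normAdj_comm.1 h⟩⟩
    rintro rfl
    exact (Finset.mem_filter.1 hv).2 h
  have hvar : ∀ U ⊆ U₀, ∑ v ∈ U, (((U.filter fun w => (normGraph F K).Adj v w).card : ℝ) -
      p * U.card) ^ 2 ≤ Q * U.card := by
    intro U hU
    refine le_trans ?_ (sum_sq_card_normAdj_sub_le U)
    refine le_trans (Finset.sum_le_sum fun v hv => le_of_eq ?_)
      (Finset.sum_le_sum_of_subset_of_nonneg (Finset.subset_univ _) fun v _ _ => sq_nonneg _)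
    rw [Finset.filter_congr fun w _ => hadj v (hU hv) w]
  have hU₀ : (1 - δ) * (q : ℝ) ^ s ≤ U₀.card := by
    have h1 : ((Finset.univ.filter fun v : K × Fˣ => normAdj v v).card : ℝ) + U₀.card =
        Q * ((q : ℝ) - 1) := by
      have h2 := Finset.card_filter_add_card_filter_not (s := (Finset.univ : Finset (K × Fˣ)))
        (fun v => normAdj v v)
      rw [Finset.card_univ, Fintype.card_prod, Fintype.card_units, hq] at h2
      have h3 := congrArg (Nat.cast (R := ℝ)) h2
      rwa [Nat.cast_add, Nat.cast_mul, Nat.cast_sub hq0, Nat.cast_one] at h3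
    have h4 : ((Finset.univ.filter fun v : K × Fˣ => normAdj v v).card : ℝ) ≤ 2 * Q := by
      rw [hQ]
      exact_mod_cast (card_filter_normAdj_self_le (F := F) (K := K))
    have h5 : (q : ℝ) ^ s = Q * q := by rw [hs, pow_succ, hQq]
    rw [h5]
    nlinarith
  have hη0 : 0 < 1 - δ := by linarith
  have hη1 : 1 - δ ≤ 1 := by linarith
  obtain ⟨k, rfl⟩ : ∃ k, m = k + 1 := ⟨m - 1, by omega⟩
  refine ⟨U₀, le_trans ?_ (le_factorial_mul_cliqueCount (normGraph F K) U₀ hp0 hp1 hδ hδ1 hvar k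
    U₀ subset_rfl (Or.inr ?_))⟩
  · have hch : (k + 1).choose 2 ≤ s * (k + 1) := by
      rw [Nat.choose_two_right, Nat.add_sub_cancel]
      refine (Nat.div_le_self _ _).trans ?_
      rw [mul_comm]
      exact Nat.mul_le_mul_right _ (by omega)
    have h1 : (q : ℝ) ^ (s * (k + 1) - (k + 1).choose 2) =
        ((q : ℝ) ^ s) ^ (k + 1) * ((q : ℝ)⁻¹) ^ ((k + 1).choose 2) := by
      rw [← pow_mul, pow_sub₀ _ hq0'.ne' hch, inv_pow]
    calc (1 - δ) ^ ((k + 1) ^ 2 + (k + 1)) * (q : ℝ) ^ (s * (k + 1) - (k + 1).choose 2)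
        = (1 - δ) ^ ((k + 1) ^ 2) * ((1 - δ) * (q : ℝ) ^ s) ^ (k + 1) *
            ((q : ℝ)⁻¹) ^ ((k + 1).choose 2) := by
          rw [h1, pow_add, mul_pow (1 - δ)]
          ring_nf
      _ ≤ _ := by gcongr
  -- Here `s ≥ 2m - 2` is decisive: up to constants the condition reads `q ^ (s-1) ≤ q ^ (2s - 2k)`
  -- with `k = m - 1`, and `2s - 2k ≥ s` leaves a spare factor `q` to absorb the constants.
  · have hexp : s + 2 * k ≤ 2 * s := by omega
    rw [hQq]
    obtain ⟨e, he⟩ : ∃ e, 2 * s = s + 2 * k + e := ⟨2 * s - (s + 2 * k), by omega⟩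
    have hk : 2 * k = 2 * (k - 1) + 2 := by omega
    have h1 : (1 - δ) ^ (2 * (k + 1)) ≤ (1 - δ) ^ (2 * (k - 1) + 2) :=
      pow_le_pow_of_le_one hη0.le hη1 (by omega)
    calc (q : ℝ) ^ d = (q : ℝ) ^ d * 1 := (mul_one _).symm
      _ ≤ (q : ℝ) ^ d * (δ ^ 3 * (1 - δ) ^ (2 * (k + 1)) * q) := by gcongr
      _ ≤ (q : ℝ) ^ d * (δ ^ 3 * (1 - δ) ^ (2 * (k - 1) + 2) * q) := by gcongr
      _ = δ ^ 3 * (1 - δ) ^ (2 * (k - 1) + 2) * (q : ℝ) ^ s := by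
          rw [hs, pow_succ]
          ring
      _ ≤ δ ^ 3 * (1 - δ) ^ (2 * (k - 1) + 2) * (q : ℝ) ^ (s + e) := by
          have : (q : ℝ) ^ s ≤ (q : ℝ) ^ (s + e) := pow_le_pow_right₀ hqone (by omega)
          gcongr
      _ = δ ^ 3 * ((q : ℝ)⁻¹) ^ 2 * ((1 - δ) * (q : ℝ)⁻¹) ^ (2 * (k - 1)) *
            ((1 - δ) * (q : ℝ) ^ s) ^ 2 := by
          have h2 : ((q : ℝ) ^ s) ^ 2 = (q : ℝ) ^ (s + e) * (q : ℝ) ^ (2 * (k - 1) + 2) := by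
            rw [← pow_mul, ← pow_add]
            congr 1
            omega
          rw [mul_pow (1 - δ), mul_pow (1 - δ), h2, pow_add (1 - δ), inv_pow, inv_pow,
            pow_add (q : ℝ) (2 * (k - 1)) 2]
          have := hq0'.ne'
          field_simp
      _ ≤ _ := by gcongr

end NormGraphCliques

/-! ### From prime powers to all `n`, and uniform constants -/

section Asymptotics

theorem exponent_eq (m s : ℕ) :
    (m : ℝ) - (m.choose 2 : ℝ) / s = (m : ℝ) - (m : ℝ) * ((m : ℝ) - 1) / (2 * s) := by
  rw [Nat.cast_choose_two, div_div]

theorem exponent_pos {m s : ℕ} (hm : 2 ≤ m) (hms : m - 1 ≤ s) :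
    0 < (m : ℝ) - (m : ℝ) * ((m : ℝ) - 1) / (2 * s) := by
  have hm' : (2 : ℝ) ≤ m := by exact_mod_cast hm
  have hs : (m : ℝ) - 1 ≤ s := by
    have : m ≤ s + 1 := by omega
    have : (m : ℝ) ≤ s + 1 := by exact_mod_cast this
    linarith
  rw [sub_pos, div_lt_iff₀ (by linarith)]
  nlinarith

theorem eventually_le_factorial_mul_exCliqueBiclique {m s t : ℕ} (hm : 2 ≤ m)
    (hms : 2 * m - 2 ≤ s) (ht : (s - 1)! + 1 ≤ t) {ε : ℝ} (hε : 0 < ε) (hε1 : ε < 1) :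
    ∀ᶠ n : ℕ in atTop, (1 - ε) * (n : ℝ) ^ ((m : ℝ) - (m : ℝ) * ((m : ℝ) - 1) / (2 * s)) ≤
      (m ! : ℝ) * exCliqueBiclique n m s t := by
  have hs : 0 < s := by omega
  have hs0 : (0 : ℝ) < s := Nat.cast_pos.2 hs
  have hch : m.choose 2 ≤ s * m := by
    rw [Nat.choose_two_right]
    refine (Nat.div_le_self _ _).trans ?_
    rw [mul_comm]
    exact Nat.mul_le_mul_right _ (by omega)
  set N := s * m - m.choose 2 with hN
  set M := m ^ 2 + m + N with hM
  -- `M` is the total number of factors `1 - δ` lost below, so Bernoulli's inequality keeps their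
  -- product above `1 - ε`.
  set δ : ℝ := ε / (M + 1) with hδ
  have hδ0 : 0 < δ := by positivity
  have hδε : δ ≤ ε := div_le_self hε.le (by linarith [(Nat.cast_nonneg M : (0 : ℝ) ≤ M)])
  have hδ1 : δ < 1 := hδε.trans_lt hε1
  have hη0 : 0 < 1 - δ := by linarith
  have hbern : 1 - ε ≤ (1 - δ) ^ M := by
    have h1 := one_add_mul_le_pow (show (-2 : ℝ) ≤ -δ by linarith) M
    have h2 : (M : ℝ) * δ ≤ ε := by
      rw [hδ, mul_div_assoc', div_le_iff₀ (by positivity)]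
      nlinarith
    calc 1 - ε ≤ 1 + M * -δ := by linarith
      _ ≤ (1 + -δ) ^ M := h1
      _ = _ := by rw [← sub_eq_add_neg]
  set x : ℕ → ℝ := fun n => (n : ℝ) ^ ((1 : ℝ) / s) with hx
  have hxlim : Tendsto x atTop atTop :=
    (tendsto_rpow_atTop (by positivity)).comp tendsto_natCast_atTop_atTop
  set B : ℝ := max (3 / δ) (1 / (δ ^ 3 * (1 - δ) ^ (2 * m))) with hB
  filter_upwards [hxlim.eventually (eventually_exists_prime_mem_Ioc hδ0),
    hxlim.eventually_ge_atTop (B / (1 - δ))] with n hn hnB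
  obtain ⟨q, hq, hq1, hq2⟩ := hn
  have hx0 : 0 ≤ x n := by positivity
  have hBq : B ≤ q := by
    rw [div_le_iff₀ hη0, mul_comm] at hnB
    exact hnB.trans hq1.le
  have hq3 : 3 ≤ δ * q := by
    have := (le_max_left _ _).trans hBq
    rwa [div_le_iff₀ hδ0, mul_comm] at this
  have hq4 : 1 ≤ δ ^ 3 * (1 - δ) ^ (2 * m) * q := by
    have := (le_max_right _ _).trans hBq
    rwa [div_le_iff₀ (by positivity), mul_comm] at this
  have := Fact.mk hq
  have hs1 : s - 1 ≠ 0 := by omega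
  let : Fintype (GaloisField q (s - 1)) := Fintype.ofFinite _
  have hfin : s = Module.finrank (ZMod q) (GaloisField q (s - 1)) + 1 := by
    rw [GaloisField.finrank q hs1]
    omega
  obtain ⟨U, hU⟩ := le_cliqueCount_normGraph (F := ZMod q) (K := GaloisField q (s - 1)) hfin hm
    hms (ZMod.card q) hδ0 hδ1 hq3 hq4
  -- The graph has `q ^ (s-1) * (q-1)` vertices, fewer than `q ^ s`, so it embeds into `n` vertices.
  have hqn : q ^ s ≤ n := by
    have h1 : (q : ℝ) ^ s ≤ x n ^ s := by gcongr
    rw [hx] at h1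
    simp only at h1
    rw [← Real.rpow_natCast ((n : ℝ) ^ ((1 : ℝ) / s)), ← Real.rpow_mul (Nat.cast_nonneg n),
      one_div_mul_cancel hs0.ne', Real.rpow_one] at h1
    exact_mod_cast h1
  have hcard : Fintype.card (GaloisField q (s - 1) × (ZMod q)ˣ) ≤ n := by
    refine le_trans ?_ hqn
    have h1 : Fintype.card (GaloisField q (s - 1)) = q ^ (s - 1) := by
      rw [← Nat.card_eq_fintype_card, GaloisField.card q _ hs1]
    rw [Fintype.card_prod, h1, ZMod.card_units_eq_totient]
    obtain ⟨k, rfl⟩ : ∃ k, s = k + 1 := ⟨s - 1, by omega⟩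
    rw [Nat.add_sub_cancel, pow_succ]
    exact Nat.mul_le_mul_left _ (Nat.totient_le q)
  have hle := cliqueCount_le_exCliqueBiclique (normGraph (ZMod q) (GaloisField q (s - 1))) m hs
    (show 0 < t by omega) hcard (free_normGraph hfin (by
      rw [GaloisField.finrank q hs1]
      omega)) U
  have hexp : (m : ℝ) - (m : ℝ) * ((m : ℝ) - 1) / (2 * s) = 1 / s * (N : ℕ) := by
    rw [← exponent_eq, hN, Nat.cast_sub hch]
    push_cast
    field_simp
  have hpow : (n : ℝ) ^ ((m : ℝ) - (m : ℝ) * ((m : ℝ) - 1) / (2 * s)) = x n ^ N := by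
    rw [hexp, Real.rpow_mul (Nat.cast_nonneg n), Real.rpow_natCast]
  rw [hpow]
  calc (1 - ε) * x n ^ N ≤ (1 - δ) ^ M * x n ^ N := by gcongr
    _ = (1 - δ) ^ (m ^ 2 + m) * ((1 - δ) * x n) ^ N := by
        rw [hM, pow_add _ (m ^ 2 + m), mul_pow, mul_assoc]
    _ ≤ (1 - δ) ^ (m ^ 2 + m) * (q : ℝ) ^ N := by gcongr
    _ ≤ _ := hU
    _ ≤ _ := by gcongr

theorem bicliqueFreeOn_univ_of_free {V : Type*} [Fintype V] (G : SimpleGraph V) {s t : ℕ}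
    (h : (completeBipartiteGraph (Fin s) (Fin t)).Free G) :
    BicliqueFreeOn G s t Finset.univ := by
  intro S _ hS
  convert card_commonNeighbors_lt_of_free G h S hS

theorem exists_le_add_mul_rpow {m s t : ℕ} (hm : 2 ≤ m) (hms : m - 1 ≤ s) (hst : s ≤ t) {ε : ℝ}
    (hε : 0 < ε) : ∃ C : ℝ, 0 ≤ C ∧ ∀ n : ℕ, (m ! : ℝ) * exCliqueBiclique n m s t ≤
      (1 + ε) * ((t : ℝ) - 1) ^ ((m : ℝ) * ((m : ℝ) - 1) / (2 * s)) *
        (n : ℝ) ^ ((m : ℝ) - (m : ℝ) * ((m : ℝ) - 1) / (2 * s)) + C := by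
  obtain ⟨k, rfl⟩ : ∃ k, m = k + 1 := ⟨m - 1, by omega⟩
  obtain ⟨C, hC, h⟩ := factorial_mul_cliqueCount_le k s t (by omega) hst (by omega) ε hε
  refine ⟨C, hC, fun n => ?_⟩
  have ht : (0 : ℝ) ≤ (t : ℝ) - 1 := by
    have : (1 : ℝ) ≤ t := by exact_mod_cast (by omega : 1 ≤ t)
    linarith
  have he : ((k + 1 : ℕ) : ℝ) * (((k + 1 : ℕ) : ℝ) - 1) = ((k : ℝ) + 1) * k := by push_cast; ring
  rw [he]
  rcases Nat.eq_zero_or_pos (exCliqueBiclique n (k + 1) s t) with h0 | hpos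
  · rw [h0, Nat.cast_zero, mul_zero]
    positivity
  · obtain ⟨G, hG, hGe⟩ := exists_exCliqueBiclique_eq n (k + 1) s t hpos
    have := h G Finset.univ (bicliqueFreeOn_univ_of_free G hG)
    rw [← hGe, Finset.card_univ, Fintype.card_fin] at this
    push_cast at this ⊢
    exact this

theorem exCliqueBiclique_zero_left {m : ℕ} (hm : 0 < m) (s t : ℕ) :
    exCliqueBiclique 0 m s t = 0 := by
  by_contra h
  obtain ⟨G, -, hG⟩ := exists_exCliqueBiclique_eq 0 m s t (Nat.pos_of_ne_zero h)
  apply h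
  rw [hG, cliqueCount, Finset.card_eq_zero, Finset.eq_empty_iff_forall_notMem]
  intro S hS
  simp only [Finset.mem_filter, Finset.mem_powersetCard] at hS
  have h1 := hS.1.2
  have h2 : S = ∅ := Finset.eq_empty_of_isEmpty S
  rw [h2, Finset.card_empty] at h1
  omega

theorem exCliqueBiclique_one_one (n : ℕ) : exCliqueBiclique n 2 1 1 = 0 := by
  by_contra h
  obtain ⟨G, hG, hGe⟩ := exists_exCliqueBiclique_eq n 2 1 1 (Nat.pos_of_ne_zero h)
  have h1 : BicliqueFreeOn G 1 1 Finset.univ := bicliqueFreeOn_univ_of_free G hG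
  have h2 := two_mul_cliqueCount_two_le h1
  omega

/-- The clique `K_m`, padded by isolated vertices, has too few nontrivial vertices to contain
`K_{s,t}`. -/
theorem one_le_exCliqueBiclique {n m s t : ℕ} (hs : 0 < s) (ht : 0 < t) (hmst : m < s + t)
    (hmn : m ≤ n) : 1 ≤ exCliqueBiclique n m s t := by
  refine le_trans ?_ (cliqueCount_le_exCliqueBiclique (⊤ : SimpleGraph (Fin m)) m hs ht
    (by simpa using hmn) ?_ Finset.univ)
  · rw [← copyCount_completeGraph, Nat.one_le_iff_ne_zero, Ne, SimpleGraph.copyCount_eq_zero,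
      SimpleGraph.not_free]
    exact SimpleGraph.IsContained.refl _
  · rintro ⟨c⟩
    have := Fintype.card_le_of_injective _ c.injective
    simp only [Fintype.card_sum, Fintype.card_fin] at this
    omega

theorem le_factorial_pred_add_one (s : ℕ) : s ≤ (s - 1)! + 1 := by
  have := Nat.self_le_factorial (s - 1)
  omega

theorem exists_upper_constant {m s t : ℕ} (hm : 2 ≤ m) (hms : m - 1 ≤ s) (hst : s ≤ t) :
    ∃ c : ℝ, 0 < c ∧ ∀ n : ℕ, (exCliqueBiclique n m s t : ℝ) ≤
      c * (n : ℝ) ^ ((m : ℝ) - (m : ℝ) * ((m : ℝ) - 1) / (2 * s)) := by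
  obtain ⟨C, hC, h⟩ := exists_le_add_mul_rpow hm hms hst one_pos
  have hβ := exponent_pos hm hms
  have ht : (0 : ℝ) ≤ (t : ℝ) - 1 := by
    have : (1 : ℝ) ≤ t := by exact_mod_cast (by omega : 1 ≤ t)
    linarith
  set A : ℝ := ((t : ℝ) - 1) ^ ((m : ℝ) * ((m : ℝ) - 1) / (2 * s))
  have hA : 0 ≤ A := Real.rpow_nonneg ht _
  refine ⟨2 * A + C + 1, by positivity, fun n => ?_⟩
  rcases Nat.eq_zero_or_pos n with rfl | hn
  · rw [exCliqueBiclique_zero_left (by omega), Nat.cast_zero, Real.zero_rpow hβ.ne', mul_zero]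
  · have h1 : 1 ≤ (n : ℝ) ^ ((m : ℝ) - (m : ℝ) * ((m : ℝ) - 1) / (2 * s)) :=
      Real.one_le_rpow (Nat.one_le_cast.2 hn) hβ.le
    have h2 : (1 : ℝ) ≤ m ! := Nat.one_le_cast.2 (Nat.factorial_pos m)
    have h3 : (exCliqueBiclique n m s t : ℝ) ≤ m ! * exCliqueBiclique n m s t :=
      le_mul_of_one_le_left (Nat.cast_nonneg _) h2
    have h4 := h n
    nlinarith

/-- The asymptotic estimate covers large `n`; for the rest the count is at least `1` and the power
of `n` is bounded. -/
theorem exists_lower_constant {m s t : ℕ} (hm : 2 ≤ m) (hms : 2 * m - 2 ≤ s)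
    (ht : (s - 1)! + 1 ≤ t) :
    ∃ c : ℝ, 0 < c ∧ ∀ n : ℕ, m ≤ n →
      (n : ℝ) ^ ((m : ℝ) - (m : ℝ) * ((m : ℝ) - 1) / (2 * s)) ≤
        c * exCliqueBiclique n m s t := by
  have hβ := exponent_pos hm (show m - 1 ≤ s by omega)
  obtain ⟨n₀, hn₀⟩ := eventually_atTop.1 (eventually_le_factorial_mul_exCliqueBiclique hm hms ht
    one_half_pos one_half_lt_one)
  set β := (m : ℝ) - (m : ℝ) * ((m : ℝ) - 1) / (2 * s)
  refine ⟨2 * m ! + (n₀ : ℝ) ^ β, by positivity, fun n hmn => ?_⟩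
  have h1 : (1 : ℝ) ≤ exCliqueBiclique n m s t := by
    exact_mod_cast one_le_exCliqueBiclique (by omega) (by omega) (by omega) hmn
  have h2 : 0 ≤ (n₀ : ℝ) ^ β := by positivity
  rcases le_total n₀ n with h | h
  · have := hn₀ n h
    nlinarith
  · have h3 : (n : ℝ) ^ β ≤ (n₀ : ℝ) ^ β := by gcongr
    have h4 : (0 : ℝ) ≤ 2 * m ! := by positivity
    nlinarith

end Asymptotics

/-! ### Assembly of the three estimates -/

theorem mainTheorem1 :
    -- order of magnitude, with constants depending only on `s` and `t`
    (∀ s t : ℕ, (s - 1)! + 1 ≤ t →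
      ∃ c₁ c₂ : ℝ, 0 < c₁ ∧ 0 < c₂ ∧
        ∀ m : ℕ, 2 ≤ m → 2 * m - 2 ≤ s → ∀ n : ℕ,
          (m ≤ n →
            c₁ * (n : ℝ) ^ ((m : ℝ) - (m.choose 2 : ℝ) / (s : ℝ)) ≤
              (exCliqueBiclique n m s t : ℝ)) ∧
          (exCliqueBiclique n m s t : ℝ) ≤
            c₂ * (n : ℝ) ^ ((m : ℝ) - (m.choose 2 : ℝ) / (s : ℝ))) ∧
    -- precise upper bound
    (∀ m s t : ℕ, 2 ≤ m → m - 1 ≤ s → s ≤ t →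
      ∃ δ : ℕ → ℝ, Tendsto δ atTop (𝓝 0) ∧ ∀ n : ℕ,
        (exCliqueBiclique n m s t : ℝ) ≤
          (1 / (m ! : ℝ) + δ n) *
            ((t : ℝ) - 1) ^ ((m : ℝ) * ((m : ℝ) - 1) / (2 * (s : ℝ))) *
            (n : ℝ) ^ ((m : ℝ) - (m : ℝ) * ((m : ℝ) - 1) / (2 * (s : ℝ)))) ∧
    -- precise lower bound
    (∀ m s t : ℕ, 2 ≤ m → 2 * m - 2 ≤ s → (s - 1)! + 1 ≤ t →
      ∃ δ : ℕ → ℝ, Tendsto δ atTop (𝓝 0) ∧ ∀ n : ℕ,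
        (1 / (m ! : ℝ) + δ n) *
            (n : ℝ) ^ ((m : ℝ) - (m : ℝ) * ((m : ℝ) - 1) / (2 * (s : ℝ))) ≤
          (exCliqueBiclique n m s t : ℝ)) := by
  refine ⟨fun s t ht => ?_, fun m s t hm hms hst => ?_, fun m s t hm hms ht => ?_⟩
  · have hst : s ≤ t := (le_factorial_pred_add_one s).trans ht
    have hlow : ∀ m : ℕ, ∃ c : ℝ, 0 < c ∧ (2 ≤ m → 2 * m - 2 ≤ s → ∀ n : ℕ, m ≤ n →
        (n : ℝ) ^ ((m : ℝ) - (m.choose 2 : ℝ) / (s : ℝ)) ≤ c * exCliqueBiclique n m s t) := by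
      intro m
      by_cases h : 2 ≤ m ∧ 2 * m - 2 ≤ s
      · obtain ⟨c, hc, h'⟩ := exists_lower_constant h.1 h.2 ht
        refine ⟨c, hc, fun _ _ n hn => ?_⟩
        rw [exponent_eq]
        exact h' n hn
      · exact ⟨1, one_pos, fun h1 h2 => absurd ⟨h1, h2⟩ h⟩
    have hupp : ∀ m : ℕ, ∃ c : ℝ, 0 < c ∧ (2 ≤ m → 2 * m - 2 ≤ s → ∀ n : ℕ,
        (exCliqueBiclique n m s t : ℝ) ≤
          c * (n : ℝ) ^ ((m : ℝ) - (m.choose 2 : ℝ) / (s : ℝ))) := by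
      intro m
      by_cases h : 2 ≤ m ∧ 2 * m - 2 ≤ s
      · obtain ⟨c, hc, h'⟩ := exists_upper_constant h.1 (show m - 1 ≤ s by omega) hst
        refine ⟨c, hc, fun _ _ n => ?_⟩
        rw [exponent_eq]
        exact h' n
      · exact ⟨1, one_pos, fun h1 h2 => absurd ⟨h1, h2⟩ h⟩
    -- From `m ≥ 2` and `2m - 2 ≤ s` follows `m ≤ s`, so only finitely many `m` occur, and summing
    -- their constants gives ones depending on `s` and `t` alone.
    choose K hK0 hK using hlow
    choose L hL0 hL using hupp
    have hne : (Finset.range (s + 1)).Nonempty := ⟨0, by simp⟩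
    have hKpos : 0 < ∑ m ∈ Finset.range (s + 1), K m := Finset.sum_pos (fun m _ => hK0 m) hne
    refine ⟨(∑ m ∈ Finset.range (s + 1), K m)⁻¹, ∑ m ∈ Finset.range (s + 1), L m,
      inv_pos.2 hKpos, Finset.sum_pos (fun m _ => hL0 m) hne, fun m hm hms n => ⟨fun hn => ?_, ?_⟩⟩
    · rw [inv_mul_le_iff₀ hKpos]
      refine (hK m hm hms n hn).trans (mul_le_mul_of_nonneg_right ?_ (Nat.cast_nonneg _))
      exact Finset.single_le_sum (fun i _ => (hK0 i).le) (Finset.mem_range.2 (by omega))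
    · refine (hL m hm hms n).trans (mul_le_mul_of_nonneg_right ?_ (by positivity))
      exact Finset.single_le_sum (fun i _ => (hL0 i).le) (Finset.mem_range.2 (by omega))
  · have hβ := exponent_pos hm hms
    -- For `t = 1` the factor `(t - 1) ^ …` vanishes and cannot be divided by; this forces `m = 2`
    -- and `s = 1`, where the extremal number is zero.
    rcases Nat.lt_or_ge t 2 with ht | ht
    · obtain rfl : m = 2 := by omega
      obtain rfl : s = 1 := by omega
      obtain rfl : t = 1 := by omega
      refine ⟨fun _ => 0, tendsto_const_nhds, fun n => ?_⟩
      rw [exCliqueBiclique_one_one]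
      norm_num
    have ht' : (0 : ℝ) < (t : ℝ) - 1 := by
      have : (2 : ℝ) ≤ t := by exact_mod_cast ht
      linarith
    set β := (m : ℝ) - (m : ℝ) * ((m : ℝ) - 1) / (2 * (s : ℝ)) with hβdef
    set A := ((t : ℝ) - 1) ^ ((m : ℝ) * ((m : ℝ) - 1) / (2 * (s : ℝ))) with hA
    have hA0 : 0 < A := Real.rpow_pos_of_pos ht' _
    have hf0 : (0 : ℝ) < m ! := Nat.cast_pos.2 (Nat.factorial_pos m)
    -- The error is the positive part of the normalised count minus `1 / m !`, so the inequality is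
    -- immediate and only convergence to zero needs the asymptotic bound. The lower bound uses the
    -- negative part in the same way.
    refine ⟨fun n => max 0 ((exCliqueBiclique n m s t : ℝ) / (A * (n : ℝ) ^ β) - 1 / m !), ?_,
      fun n => ?_⟩
    · have hlim : Tendsto (fun n : ℕ => (n : ℝ) ^ β) atTop atTop :=
        (tendsto_rpow_atTop hβ).comp tendsto_natCast_atTop_atTop
      refine tendsto_order.2 ⟨fun b hb => Eventually.of_forall fun n =>
        hb.trans_le (le_max_left _ _), fun ε hε => ?_⟩
      have hε' : 0 < ε * m ! / 4 := by positivity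
      obtain ⟨C, hC, h⟩ := exists_le_add_mul_rpow hm hms hst hε'
      filter_upwards [hlim.eventually_ge_atTop (4 * C / (A * (ε * m !)) + 1)] with n hn
      refine max_lt hε ?_
      have hn0 : 0 < (n : ℝ) ^ β := by
        have : 0 ≤ 4 * C / (A * (ε * m !)) := by positivity
        linarith
      have h1 := h n
      have h2 : C ≤ ε * m ! / 4 * (A * (n : ℝ) ^ β) := by
        have : 4 * C / (A * (ε * m !)) ≤ (n : ℝ) ^ β := by linarith
        rw [div_le_iff₀ (by positivity)] at this
        nlinarith
      rw [sub_lt_iff_lt_add, div_lt_iff₀ (by positivity)]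
      have h3 : (m ! : ℝ) * exCliqueBiclique n m s t <
          (m ! : ℝ) * ((ε + 1 / m !) * (A * (n : ℝ) ^ β)) := by
        have h4 : (m ! : ℝ) * ((ε + 1 / m !) * (A * (n : ℝ) ^ β)) =
            (ε * m ! + 1) * (A * (n : ℝ) ^ β) := by field_simp
        rw [h4]
        have h5 : 0 < ε * m ! * (A * (n : ℝ) ^ β) := by positivity
        have h6 : (m ! : ℝ) * exCliqueBiclique n m s t ≤
            (1 + ε * m ! / 4) * (A * (n : ℝ) ^ β) + C := by
          rw [← mul_assoc]
          exact h1
        linarith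
      exact lt_of_mul_lt_mul_left h3 hf0.le
    · rcases Nat.eq_zero_or_pos n with rfl | hn
      · rw [exCliqueBiclique_zero_left (by omega), Nat.cast_zero, Real.zero_rpow hβ.ne', mul_zero]
      · have hn0 : 0 < A * (n : ℝ) ^ β := by positivity
        rw [mul_assoc, ← div_le_iff₀ hn0]
        have := le_max_right 0 ((exCliqueBiclique n m s t : ℝ) / (A * (n : ℝ) ^ β) - 1 / m !)
        linarith
  · have hβ := exponent_pos hm (show m - 1 ≤ s by omega)
    set β := (m : ℝ) - (m : ℝ) * ((m : ℝ) - 1) / (2 * (s : ℝ)) with hβdef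
    have hf0 : (0 : ℝ) < m ! := Nat.cast_pos.2 (Nat.factorial_pos m)
    refine ⟨fun n => min 0 ((exCliqueBiclique n m s t : ℝ) / (n : ℝ) ^ β - 1 / m !), ?_,
      fun n => ?_⟩
    · refine tendsto_order.2 ⟨fun b hb => ?_, fun b hb => Eventually.of_forall fun n =>
        (min_le_left _ _).trans_lt hb⟩
      set ε : ℝ := min (1 / 2) (-b * m ! / 2) with hε
      have hb' : 0 < -b := by linarith
      have hε0 : 0 < ε := by positivity
      have hε1 : ε < 1 := (min_le_left _ _).trans_lt one_half_lt_one
      have hεb : ε ≤ -b * m ! / 2 := min_le_right _ _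
      filter_upwards [eventually_le_factorial_mul_exCliqueBiclique hm hms ht hε0 hε1,
        eventually_gt_atTop 0] with n hn hn1
      have hn0 : 0 < (n : ℝ) ^ β := Real.rpow_pos_of_pos (Nat.cast_pos.2 hn1) _
      refine lt_min hb ?_
      rw [lt_sub_iff_add_lt, lt_div_iff₀ hn0]
      have h1 : (m ! : ℝ) * ((b + 1 / m !) * (n : ℝ) ^ β) <
          (m ! : ℝ) * exCliqueBiclique n m s t := by
        have h4 : (m ! : ℝ) * ((b + 1 / m !) * (n : ℝ) ^ β) = (1 - -b * m !) * (n : ℝ) ^ β := by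
          field_simp
          ring
        rw [h4]
        refine lt_of_lt_of_le ?_ hn
        have h5 : 0 < -b * m ! := by positivity
        refine mul_lt_mul_of_pos_right ?_ hn0
        linarith
      exact lt_of_mul_lt_mul_left h1 hf0.le
    · rcases Nat.eq_zero_or_pos n with rfl | hn
      · rw [Nat.cast_zero, Real.zero_rpow hβ.ne', mul_zero]
        exact Nat.cast_nonneg _
      · have hn0 : 0 < (n : ℝ) ^ β := by positivity
        rw [← le_div_iff₀ hn0]
        have := min_le_right 0 ((exCliqueBiclique n m s t : ℝ) / (n : ℝ) ^ β - 1 / m !)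
        linarith
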